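/- **Setting.** Let $m_Z>m_W>0$, $m_H>0$, $m_e>0$, $m_\nu\ge 0$ with $m_e\neq m_\nu$, let $g\ne0$ be real, and let $\Theta$ be the Weinberg angle, $\cos\Theta=m_W/m_Z$. Let $A_1=W_1,\ A_2=W_2,\ A_3=Z,\ A_4=A$ (photon) be the free string-local potentials $A_a^\mu(x,l)=\int_0^\infty F_a^{\mu\lambda}(x+sl)\,l_\lambda\,ds$ of masses $m_1=m_2=m_W$, $m_3=m_Z$, $m_4=0$ ($l$ lightlike and future-pointing), $\phi_a$ ($a=1,2,3$) their escort fields (so that $A_a-\partial\phi_a$ is a pointlike Proca field), $w_a=d_l\phi_a$ (for the photon $w_4$ is given by the same formula, so that $d_lA_4^\mu=\partial^\mu w_4$), $\phi_4$ the pointlike higgs field of mass $m_H$, $e,\nu$ free Dirac fields, and $W_\pm=(W_1\mp iW_2)/\sqrt2$, likewise $\phi_\pm$. Let $f_{abc}$ be totally skew with $f_{123}=\frac12\cos\Theta$, $f_{124}=\frac12\sin\Theta$, $f_{134}=f_{234}=0$. Consider the most general charge-conserving, Lorentz-invariant, renormalizable coupling of these bosons to the leptons, $$\begin{aligned}S_1^F=g\bigl(&W_{-\mu}\bar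 e\gamma^\mu(b_1+\tilde b_1\gamma^5)\nu+W_{+\mu}\bar\nu\gamma^\mu(b_2+\tilde b_2\gamma^5)e+Z_\mu\bar e\gamma^\mu(b_3+\tilde b_3\gamma^5)e+Z_\mu\bar\nu\gamma^\mu(b_4+\tilde b_4\gamma^5)\nu\\&+A_\mu\bar e\gamma^\mu(b_5+\tilde b_5\gamma^5)e+A_\mu\bar\nu\gamma^\mu(b_6+\tilde b_6\gamma^5)\nu+\phi_-\bar e(c_1+\tilde c_1\gamma^5)\nu+\phi_+\bar\nu(c_2+\tilde c_2\gamma^5)e\\&+\phi_Z\bar e(c_3+\tilde c_3\gamma^5)e+\phi_Z\bar\nu(c_4+\tilde c_4\gamma^5)\nu+\phi_4\bar e(c_0+\tilde c_0\gamma^5)e+\phi_4\bar\nu(c_5+\tilde c_5\gamma^5)\nu\bigr)\end{aligned}$$ with complex coefficients such that $S_1^F$ is Hermitian, with $b_6=\tilde b_6=0$ (the photon does not couple to the neutrino), and with $(b_1,\tilde b_1)\neq(0,0)$ (the leptons do couple to $W_\pm$). **String independence.** Assume: 1. (First order) there is a Lorentz covariant Wick polynomial without derivatives $Q_1^{F\mu}=g\sum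 w_a\,\bar\psi_f\gamma^\mu(q_{aff'}+\tilde q_{aff'}\gamma^5)\psi_{f'}$ with $d_lS_1^F=\partial_\mu Q_1^{F\mu}$. 2. (Second order, tree graphs with two external leptons) Put $Q_1=Q_1^B+Q_1^F$, where $$Q_1^{B\mu}=2g\sum f_{abc}F_a^{\mu\lambda}A_{c\lambda}w_b+g\sum{}' f_{abc}(m_a^2+m_c^2-m_b^2)(A_a-\partial\phi_a)^\mu\phi_cw_b+g\sum_{b\le3}\frac{m_b^2}{2m_W}\bigl(\phi_4(\partial\phi_b-A_b)^\mu-\partial^\mu\phi_4\,\phi_b\bigr)w_b$$ is the vector of the boson self-couplings ($\sum'$: $a,c\le3$, $b\le4$). Let $\langle T\cdot\,\cdot\rangle$ be time-ordered two-point functions obtained from $\frac{i}{p^2-m^2}M(p,l)$, $M$ the sum over polarizations of products of intertwiners, up to the renormalization $\langle T\,\partial_\lambda A_{a\mu}A'_{a\kappa}\rangle\to\langle T\,\partial_\lambda A_{a\mu}A'_{a\kappa}\rangle+c^a_{\lambda\mu\kappa}\delta_l$ with $\delta_l(x'-x)=\int_0^\infty\delta(x'-x-sl)\,ds$. Then,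 for some choice of the functions $c^a_{\lambda\mu\kappa}(x'-x,l)$, the total obstruction $$\sum_{C,\chi'}\frac{\partial Q_1^\mu}{\partial C^\mu}\,\mathcal O(C,\chi')\,\frac{\partial S_1^{F\prime}}{\partial\chi'}+[x\leftrightarrow x'],\qquad\mathcal O(C,\chi')=\langle T\,\partial_\mu C^\mu\,\chi'\rangle-\partial_\mu\langle T\,C^\mu\chi'\rangle,$$ vanishes, where the sum is over all contractions of a vector field $C\in\{A_a,\partial\phi_a,F_a^{\cdot\lambda},\partial\phi_4,\gamma\psi,\bar\psi\gamma\}$ of $Q_1$ with a field $\chi$ of $S_1^F$, and $\partial_\mu C^\mu$ is expressed through the free field equations. **Theorem (chirality theorem).** Then there are a sign $\varepsilon_1\in\{1,-1\}$ and a phase $\zeta$, $|\zeta|=1$, such that $$b_1=\bar b_2=-\frac{\zeta}{2\sqrt2},\quad\tilde b_1=\varepsilon_1b_1,\quad\tilde b_2=\varepsilon_1b_2,\quad b_3=\frac{1-4\sin^2\Theta}{4\cos\Theta},\quad\tilde b_3=\frac{\varepsilon_1}{4\cos\Theta},\quad b_4=-\frac1{4\cos\Theta},\quad\tilde b_4=-\frac{\varepsilon_1}{4\cos\Theta},$$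 $$b_5=\sin\Theta,\quad\tilde b_5=0,\quad c_1=i(m_e-m_\nu)b_1,\quad\tilde c_1=i(m_e+m_\nu)\tilde b_1,\quad c_2=-i(m_e-m_\nu)b_2,\quad\tilde c_2=i(m_e+m_\nu)\tilde b_2,$$ $$c_3=c_4=0,\quad\tilde c_3=\frac{i\varepsilon_1m_e}{2\cos\Theta},\quad\tilde c_4=-\frac{i\varepsilon_1m_\nu}{2\cos\Theta},\quad c_0=\frac{m_e}{2m_W},\quad c_5=\frac{m_\nu}{2m_W},\quad\tilde c_0=\tilde c_5=0.$$ The phase $\zeta$ is conventional (it is absorbed by replacing $e$ by $\zeta e$). With $\varepsilon_1=-1$ and $\zeta=1$, $$\begin{aligned}S_1^F=g\Bigl\{&-\tfrac1{2\sqrt2}W_{-\mu}\bar e\gamma^\mu(1-\gamma^5)\nu-\tfrac1{2\sqrt2}W_{+\mu}\bar\nu\gamma^\mu(1-\gamma^5)e+\tfrac{1-4\sin^2\Theta}{4\cos\Theta}Z_\mu\bar e\gamma^\mu e-\tfrac1{4\cos\Theta}Z_\mu\bar e\gamma^\mu\gamma^5e\\&-\tfrac1{4\cos\Theta}Z_\mu\bar\nu\gamma^\mu(1-\gamma^5)\nu+\sin\Theta\,A_\mu\bar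 e\gamma^\mu e-i\tfrac{m_e-m_\nu}{2\sqrt2}(\phi_-\bar e\nu-\phi_+\bar\nu e)+i\tfrac{m_e+m_\nu}{2\sqrt2}(\phi_-\bar e\gamma^5\nu+\phi_+\bar\nu\gamma^5e)\\&-i\tfrac{m_e}{2\cos\Theta}\phi_Z\bar e\gamma^5e+i\tfrac{m_\nu}{2\cos\Theta}\phi_Z\bar\nu\gamma^5\nu+\tfrac{m_e}{2m_W}\phi_4\bar ee+\tfrac{m_\nu}{2m_W}\phi_4\bar\nu\nu\Bigr\}.\end{aligned}$$ -/

import Mathlib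

open Complex Matrix

noncomputable section

namespace StringLocal

/-! ## Minkowski space, Dirac matrices -/

/-- Diagonal of the Minkowski metric `diag(1,-1,-1,-1)`.  All vectors below are given by their
contravariant components. -/
def eta (μ : Fin 4) : ℝ := if μ = 0 then 1 else -1

/-- Minkowski product of two real vectors. -/
def mdot (p q : Fin 4 → ℝ) : ℝ := ∑ μ, eta μ * p μ * q μ

/-- Minkowski product of a real vector and a complex vector. -/
def cdot (p : Fin 4 → ℝ) (e : Fin 4 → ℂ) : ℂ := ∑ μ, (eta μ : ℂ) * (p μ : ℂ) * e μ

/-- The Dirac matrices `γ^μ` (chiral representation). -/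
def gam : Fin 4 → Matrix (Fin 4) (Fin 4) ℂ
  | 0 => !![0, 0, 1, 0; 0, 0, 0, 1; 1, 0, 0, 0; 0, 1, 0, 0]
  | 1 => !![0, 0, 0, 1; 0, 0, 1, 0; 0, -1, 0, 0; -1, 0, 0, 0]
  | 2 => !![0, 0, 0, -I; 0, 0, I, 0; 0, I, 0, 0; -I, 0, 0, 0]
  | 3 => !![0, 0, 1, 0; 0, 0, 0, -1; -1, 0, 0, 0; 0, 1, 0, 0]

/-- `γ⁵ = i γ⁰γ¹γ²γ³`. -/
def gam5 : Matrix (Fin 4) (Fin 4) ℂ := I • (gam 0 * gam 1 * gam 2 * gam 3)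

/-- `p̸ = p_μ γ^μ`. -/
def slash (p : Fin 4 → ℝ) : Matrix (Fin 4) (Fin 4) ℂ :=
  ∑ μ, ((eta μ : ℂ) * (p μ : ℂ)) • gam μ

/-! ## Physical data -/

/-- Overall coupling strength, masses, and Weinberg angle. -/
structure Params where
  g : ℝ
  mW : ℝ
  mZ : ℝ
  mH : ℝ
  me : ℝ
  mν : ℝ
  Θ : ℝ

/-- Masses of the vector bosons.  The species `0, 1, 2, 3` are the hermitian fields
`A_1 = W_1`, `A_2 = W_2`, `A_3 = Z`, `A_4 = A` (photon). -/
def Params.mass (P : Params) : Fin 4 → ℝ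
  | 0 => P.mW
  | 1 => P.mW
  | 2 => P.mZ
  | 3 => 0

/-- The two leptons of one generation. -/
inductive Lepton
  | e
  | ν
  deriving DecidableEq

instance : Fintype Lepton := ⟨{Lepton.e, Lepton.ν}, fun x => by cases x <;> decide⟩

/-- Lepton masses. -/
def Params.lmass (P : Params) : Lepton → ℝ
  | .e => P.me
  | .ν => P.mν

/-- The generalized Kronecker delta: the sign of the permutation that takes `(i,j,k)` to
`(a,b,c)`, and zero if there is none (for distinct `i, j, k`). -/
def kron3 (i j k a b c : Fin 4) : ℝ :=
  Matrix.det !![(if a = i then 1 else 0 : ℝ), (if a = j then 1 else 0), (if a = k then 1 else 0);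
    (if b = i then 1 else 0), (if b = j then 1 else 0), (if b = k then 1 else 0);
    (if c = i then 1 else 0), (if c = j then 1 else 0), (if c = k then 1 else 0)]

/-- The structure constants of `u(2)`: totally skew, with `f_{123} = cos Θ / 2`,
`f_{124} = sin Θ / 2`, `f_{134} = f_{234} = 0`. -/
def Params.f (P : Params) (a b c : Fin 4) : ℝ :=
  Real.cos P.Θ / 2 * kron3 0 1 2 a b c + Real.sin P.Θ / 2 * kron3 0 1 3 a b c

/-! ## The Ansatz for the coupling of the bosons to the leptons

The coefficients of the most general charge conserving, Lorentz invariant coupling of scaling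
dimension at most four, where `W_± = (W_1 ∓ i W_2)/√2` and likewise for the escort fields `φ_±`:

`S_1^F = g ( W_{-μ} ē γ^μ (b1 + bt1 γ⁵) ν + W_{+μ} ν̄ γ^μ (b2 + bt2 γ⁵) e`
`  + Z_μ ē γ^μ (b3 + bt3 γ⁵) e + Z_μ ν̄ γ^μ (b4 + bt4 γ⁵) ν`
`  + A_μ ē γ^μ (b5 + bt5 γ⁵) e + A_μ ν̄ γ^μ (b6 + bt6 γ⁵) ν`
`  + φ_- ē (c1 + ct1 γ⁵) ν + φ_+ ν̄ (c2 + ct2 γ⁵) e`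
`  + φ_Z ē (c3 + ct3 γ⁵) e + φ_Z ν̄ (c4 + ct4 γ⁵) ν`
`  + φ_4 ē (c0 + ct0 γ⁵) e + φ_4 ν̄ (c5 + ct5 γ⁵) ν )`. -/
@[ext] structure Couplings where
  b1 : ℂ
  bt1 : ℂ
  b2 : ℂ
  bt2 : ℂ
  b3 : ℂ
  bt3 : ℂ
  b4 : ℂ
  bt4 : ℂ
  b5 : ℂ
  bt5 : ℂ
  b6 : ℂ
  bt6 : ℂ
  c1 : ℂ
  ct1 : ℂ
  c2 : ℂ
  ct2 : ℂ
  c3 : ℂ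
  ct3 : ℂ
  c4 : ℂ
  ct4 : ℂ
  c0 : ℂ
  ct0 : ℂ
  c5 : ℂ
  ct5 : ℂ

/-- Coefficient of a hermitian field of species `a`, between `ψ̄_f` and `ψ_{f'}`, from the
coefficients `xm` of the `W_-` term, `xp` of the `W_+` term, `ze, zn` of the `Z` terms and
`ae, an` of the photon terms. -/
def realBasis (xm xp ze zn ae an : ℂ) (a : Fin 4) (f f' : Lepton) : ℂ :=
  match a, f, f' with
  | 0, .e, .ν => xm / (Real.sqrt 2 : ℂ)
  | 0, .ν, .e => xp / (Real.sqrt 2 : ℂ)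
  | 1, .e, .ν => I * xm / (Real.sqrt 2 : ℂ)
  | 1, .ν, .e => -I * xp / (Real.sqrt 2 : ℂ)
  | 2, .e, .e => ze
  | 2, .ν, .ν => zn
  | 3, .e, .e => ae
  | 3, .ν, .ν => an
  | _, _, _ => 0

namespace Couplings

/-- The spinor matrix in `A_{aμ} ψ̄_f (⋯)^μ ψ_{f'}`. -/
def vec (κ : Couplings) (a : Fin 4) (f f' : Lepton) (μ : Fin 4) : Matrix (Fin 4) (Fin 4) ℂ :=
  gam μ * (realBasis κ.b1 κ.b2 κ.b3 κ.b4 κ.b5 κ.b6 a f f' • 1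
    + realBasis κ.bt1 κ.bt2 κ.bt3 κ.bt4 κ.bt5 κ.bt6 a f f' • gam5)

/-- The spinor matrix in `φ_a ψ̄_f (⋯) ψ_{f'}` (zero for the photon, which has no escort). -/
def scal (κ : Couplings) (a : Fin 4) (f f' : Lepton) : Matrix (Fin 4) (Fin 4) ℂ :=
  realBasis κ.c1 κ.c2 κ.c3 κ.c4 0 0 a f f' • 1
    + realBasis κ.ct1 κ.ct2 κ.ct3 κ.ct4 0 0 a f f' • gam5

/-- The spinor matrix in `φ_4 ψ̄_f (⋯) ψ_{f'}`, with `φ_4` the higgs field. -/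
def higgs (κ : Couplings) (f f' : Lepton) : Matrix (Fin 4) (Fin 4) ℂ :=
  match f, f' with
  | .e, .e => κ.c0 • 1 + κ.ct0 • gam5
  | .ν, .ν => κ.c5 • 1 + κ.ct5 • gam5
  | _, _ => 0

/-- Hermiticity of `S_1^F`: the adjoint of `ψ̄_f Γ ψ_{f'}` is `ψ̄_{f'} γ⁰ Γ† γ⁰ ψ_f`. -/
def IsHermitian (κ : Couplings) : Prop :=
  (∀ a f f' μ, κ.vec a f' f μ = gam 0 * (κ.vec a f f' μ)ᴴ * gam 0) ∧
  (∀ a f f', κ.scal a f' f = gam 0 * (κ.scal a f f')ᴴ * gam 0) ∧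
  (∀ f f', κ.higgs f' f = gam 0 * (κ.higgs f f')ᴴ * gam 0)

end Couplings

/-! ## String-local free fields and their intertwiners

A free field is given by its intertwiner, that is, by its matrix element between the vacuum and a
one-particle state with momentum `k` and polarization `e`; the field with string direction `l` then
has the matrix element `u(k,l,e) exp(-i(kx))`.  A creation operator is covered by `-k`. -/

/-- The linear fields built from one vector boson: string-local potential `A^μ`, Faraday tensor
`F^{μν}`, escort field `φ` and its derivatives `∂^μ φ`. -/
inductive BField
  | A (μ : Fin 4)
  | F (μ ν : Fin 4)
  | phi
  | dphi (μ : Fin 4)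

/-- Intertwiners of the annihilation parts. -/
def annih (X : BField) (k l : Fin 4 → ℝ) (e : Fin 4 → ℂ) : ℂ :=
  match X with
  | .A μ => e μ - (k μ : ℂ) * (cdot l e / (mdot k l : ℂ))
  | .F μ ν => -I * ((k μ : ℂ) * e ν - (k ν : ℂ) * e μ)
  | .phi => -I * (cdot l e / (mdot k l : ℂ))
  | .dphi μ => -I * (k μ : ℂ) * (-I * (cdot l e / (mdot k l : ℂ)))

/-- Intertwiner of the form-valued field `w = d_l φ` (for the photon it is defined by the same
formula), evaluated on a tangent vector `t` of the light cone at `l`. -/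
def wField (k l t : Fin 4 → ℝ) (e : Fin 4 → ℂ) : ℂ :=
  -I * (cdot t e / (mdot k l : ℂ) - (mdot k t : ℂ) * cdot l e / (mdot k l : ℂ) ^ 2)

/-- The vector fields `C^μ` whose divergences are contracted: `A^μ`, `∂^μ φ`, and `F^{μλ}`. -/
inductive VField
  | A
  | dphi
  | F (lam : Fin 4)

/-- The components of a vector field. -/
def VField.comp (V : VField) (μ : Fin 4) : BField :=
  match V with
  | .A => .A μ
  | .dphi => .dphi μ
  | .F lam => .F μ lam

/-- The divergences `∂_μ C^μ` according to the free field equations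
`∂_μ A^μ = -m² φ`, `□ φ = -m² φ`, `∂_μ F^{μλ} = -m² (A^λ - ∂^λ φ)`,
as seen by a linear evaluation `ev` of the fields. -/
def onShellDiv (m : ℝ) (V : VField) (ev : BField → ℂ) : ℂ :=
  match V with
  | .A => -(m : ℂ) ^ 2 * ev .phi
  | .dphi => -(m : ℂ) ^ 2 * ev .phi
  | .F lam => -(m : ℂ) ^ 2 * (ev (.A lam) - ev (.dphi lam))

/-- The free field equations hold on the mass shell. -/
theorem onShellDiv_annih (m : ℝ) (V : VField) (k l : Fin 4 → ℝ) (e : Fin 4 → ℂ)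
    (hk : mdot k k = m ^ 2) (he : cdot k e = 0) (hl : mdot k l ≠ 0) :
    onShellDiv m V (fun X => annih X k l e)
      = ∑ μ, (eta μ : ℂ) * (-I * (k μ : ℂ)) * annih (V.comp μ) k l e := by
  have hk' : ((mdot k k : ℝ) : ℂ) = (m : ℂ) ^ 2 := by rw [hk]; push_cast; rfl
  rw [← Complex.ofReal_ne_zero] at hl
  generalize hs : cdot l e / (mdot k l : ℂ) = s
  have I2 : I * I = -1 := Complex.I_mul_I
  cases V with
  | A =>
    simp only [onShellDiv, annih, VField.comp, hs, ← hk']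
    simp only [mdot, cdot, Fin.sum_univ_four, eta] at he ⊢
    push_cast
    simp at he ⊢
    linear_combination I * he
  | dphi =>
    simp only [onShellDiv, annih, VField.comp, hs, ← hk']
    simp only [mdot, Fin.sum_univ_four, eta]
    push_cast
    simp
    linear_combination (I * s * ((k 0 : ℂ) ^ 2 - (k 1 : ℂ) ^ 2 - (k 2 : ℂ) ^ 2
      - (k 3 : ℂ) ^ 2)) * I2
  | F lam =>
    simp only [onShellDiv, annih, VField.comp, hs, ← hk']
    simp only [mdot, cdot, Fin.sum_univ_four, eta] at he ⊢
    push_cast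
    simp at he ⊢
    ring_nf at he ⊢
    simp only [Complex.I_sq]
    linear_combination (-(k lam : ℂ)) * he

/-! ## Time-ordered two-point functions

Two-point functions are given in momentum space: `D(p)` stands for
`(2π)⁻⁴ ∫ d⁴p exp(-i(p(x-x'))) D(p)`, so that `∂_μ` acts as `-i p_μ` and `δ(x-x')` is `D = 1`. -/

/-- Polarization sum: `-g^{ρσ} + p^ρ p^σ / m²` for mass `m > 0`, and `-g^{ρσ}` for `m = 0`. -/
def polSum (m : ℝ) (p : Fin 4 → ℝ) (ρ σ : Fin 4) : ℝ :=
  (if ρ = σ then -eta ρ else 0) + (if m = 0 then 0 else p ρ * p σ / m ^ 2)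

/-- The function `M^{XY}(p,l) = ∑_r u^X_r(p,l)^* u^Y_r(p,l)`. -/
def Mfun (m : ℝ) (X Y : BField) (p l : Fin 4 → ℝ) : ℂ :=
  ∑ ρ, ∑ σ, (polSum m p ρ σ : ℂ) * annih X p l (Pi.single ρ 1)
    * (starRingEnd ℂ) (annih Y p l (Pi.single σ 1))

/-- `⟨T₀ X Y'⟩`. -/
def T0 (m : ℝ) (X Y : BField) (p l : Fin 4 → ℝ) : ℂ :=
  I / ((mdot p p - m ^ 2 : ℝ) : ℂ) * Mfun m X Y p l

/-- The freedom in the time ordering: `⟨T ∂_λ A_μ A'_κ⟩ = ⟨T₀ ∂_λ A_μ A'_κ⟩ + c_{λμκ} δ_l`, one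
`c` for each species of vector boson.  The second summand is a function times the delta function of
the string; in momentum space this is a function of `l` and `(pl)` alone, here
`c a l (pl) λ μ κ`. -/
abbrev Renorm := Fin 4 → (Fin 4 → ℝ) → ℝ → Fin 4 → Fin 4 → Fin 4 → ℂ

/-- The general time-ordered two-point function `⟨T X Y'⟩` of species `a`. -/
def TO (P : Params) (c : Renorm) (a : Fin 4) (X Y : BField) (p l : Fin 4 → ℝ) : ℂ :=
  T0 (P.mass a) X Y p l +
    match X, Y with
    | .F μ ν, .A κ => c a l (mdot p l) μ ν κ - c a l (mdot p l) ν μ κ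
    | _, _ => 0

/-- The two-point obstruction `𝒪(C, Y') = ⟨T ∂_μ C^μ Y'⟩ - ∂_μ ⟨T C^μ Y'⟩` of species `a`. -/
def obs (P : Params) (c : Renorm) (a : Fin 4) (V : VField) (Y : BField) (p l : Fin 4 → ℝ) : ℂ :=
  onShellDiv (P.mass a) V (fun X => TO P c a X Y p l)
    - ∑ μ, (eta μ : ℂ) * (-I * (p μ : ℂ)) * TO P c a (V.comp μ) Y p l

/-- `⟨T₀ φ_4 φ_4'⟩` for the higgs field. -/
def higgsT0 (P : Params) (p : Fin 4 → ℝ) : ℂ := I / ((mdot p p - P.mH ^ 2 : ℝ) : ℂ)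

/-- The two-point obstruction
`𝒪(∂φ_4, φ_4') = ⟨T₀ □φ_4 φ_4'⟩ - ∂_μ ⟨T₀ ∂^μ φ_4 φ_4'⟩`, with `□φ_4 = -m_H² φ_4`. -/
def obsHiggs (P : Params) (p : Fin 4 → ℝ) : ℂ :=
  -(P.mH : ℂ) ^ 2 * higgsT0 P p
    - ∑ μ, (eta μ : ℂ) * (-I * (p μ : ℂ)) * (-I * (p μ : ℂ) * higgsT0 P p)

/-- `⟨T₀ ψ(x) ψ̄(x')⟩` for a Dirac field of mass `m`. -/
def diracT0 (m : ℝ) (p : Fin 4 → ℝ) : Matrix (Fin 4) (Fin 4) ℂ :=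
  (I / ((mdot p p - m ^ 2 : ℝ) : ℂ)) • (slash p + (m : ℂ) • 1)

/-- The two-point obstruction
`𝒪(γψ, ψ̄') = ⟨T₀ γ^μ ∂_μ ψ ψ̄'⟩ - γ^μ ∂_μ ⟨T₀ ψ ψ̄'⟩`, with `γ^μ ∂_μ ψ = -i m ψ`. -/
def obsRight (m : ℝ) (p : Fin 4 → ℝ) : Matrix (Fin 4) (Fin 4) ℂ :=
  (-I * (m : ℂ)) • diracT0 m p
    - ∑ μ, ((eta μ : ℂ) * (-I * (p μ : ℂ))) • (gam μ * diracT0 m p)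

/-- The two-point obstruction
`𝒪(ψ', ψ̄γ) = ⟨T₀ ψ' ∂_μ ψ̄⟩ γ^μ - ∂_μ ⟨T₀ ψ' ψ̄⟩ γ^μ`, with `∂_μ ψ̄ γ^μ = i m ψ̄`.
Here `⟨T₀ ψ(x') ψ̄(x)⟩` has the momentum space function `diracT0 m (-p)`. -/
def obsLeft (m : ℝ) (p : Fin 4 → ℝ) : Matrix (Fin 4) (Fin 4) ℂ :=
  (I * (m : ℂ)) • diracT0 m (-p)
    - ∑ μ, ((eta μ : ℂ) * (-I * (p μ : ℂ))) • (diracT0 m (-p) * gam μ)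

/-! ## External particles

Wick polynomials are given by their matrix elements between the vacuum and states of one particle
for each field (with either sign of the energy). -/

/-- A vector boson of species `a`, with momentum `k` and polarization `e`. -/
structure BosonLeg where
  a : Fin 4
  k : Fin 4 → ℝ
  e : Fin 4 → ℂ

/-- A lepton entering through `ψ` (or through `ψ̄`), with momentum and spinor. -/
structure FermionLeg where
  f : Lepton
  k : Fin 4 → ℝ
  u : Fin 4 → ℂ

/-- A vector boson or a higgs particle. -/
inductive ExtBoson
  | gauge (y : BosonLeg)
  | higgs (k : Fin 4 → ℝ)

def ExtBoson.mom : ExtBoson → (Fin 4 → ℝ)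
  | .gauge y => y.k
  | .higgs k => k

/-- On the mass shell, off the singularity of the intertwiners, transversal polarization. -/
def BosonLeg.OnShell (P : Params) (l : Fin 4 → ℝ) (y : BosonLeg) : Prop :=
  mdot y.k y.k = P.mass y.a ^ 2 ∧ mdot y.k l ≠ 0 ∧ cdot y.k y.e = 0

def ExtBoson.OnShell (P : Params) (l : Fin 4 → ℝ) : ExtBoson → Prop
  | .gauge y => y.OnShell P l
  | .higgs k => mdot k k = P.mH ^ 2

/-- A factor `u exp(-i(kx))` solving the Dirac equation `∂̸ψ = -i m ψ`. -/
def FermionLeg.OnShell (P : Params) (ψ : FermionLeg) : Prop :=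
  mdot ψ.k ψ.k = P.lmass ψ.f ^ 2 ∧ ψ.k ≠ 0 ∧ slash ψ.k *ᵥ ψ.u = (P.lmass ψ.f : ℂ) • ψ.u

/-- A factor `u exp(-i(kx))` solving the conjugate Dirac equation `∂_μ ψ̄ γ^μ = i m ψ̄`. -/
def FermionLeg.OnShellBar (P : Params) (ψ : FermionLeg) : Prop :=
  mdot ψ.k ψ.k = P.lmass ψ.f ^ 2 ∧ ψ.k ≠ 0 ∧ ψ.u ᵥ* slash ψ.k = -(P.lmass ψ.f : ℂ) • ψ.u

/-- The string direction `l` is lightlike and points to the future. -/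
def IsString (l : Fin 4 → ℝ) : Prop := mdot l l = 0 ∧ 0 < l 0

/-- The field `A_a^μ` on the leg. -/
def BosonLeg.A (y : BosonLeg) (l : Fin 4 → ℝ) (μ : Fin 4) : ℂ := annih (.A μ) y.k l y.e

/-- The escort field `φ_a` on the leg; there is none for the photon. -/
def BosonLeg.phi (y : BosonLeg) (l : Fin 4 → ℝ) : ℂ :=
  if y.a = 3 then 0 else annih .phi y.k l y.e

/-- The field `w_a` on the leg. -/
def BosonLeg.w (y : BosonLeg) (l t : Fin 4 → ℝ) : ℂ := wField y.k l t y.e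

/-! ## First order -/

/-- Spinor matrix of `A_{aμ} ψ̄_f (⋯)^μ ψ_{f'} + φ_a ψ̄_f (⋯) ψ_{f'}`, respectively
`φ_4 ψ̄_f (⋯) ψ_{f'}`, with the boson field evaluated on the leg. -/
def vertex (κ : Couplings) (l : Fin 4 → ℝ) (X : ExtBoson) (f f' : Lepton) :
    Matrix (Fin 4) (Fin 4) ℂ :=
  match X with
  | .gauge y => (∑ μ, ((eta μ : ℂ) * y.A l μ) • κ.vec y.a f f' μ) + y.phi l • κ.scal y.a f f'
  | .higgs _ => κ.higgs f f'

/-- The matrix elements of `S_1^F(x,l)` at `x = 0`. -/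
def S1F (P : Params) (κ : Couplings) (l : Fin 4 → ℝ) (X : ExtBoson) (ψb ψ : FermionLeg) : ℂ :=
  (P.g : ℂ) * (ψb.u ⬝ᵥ (vertex κ l X ψb.f ψ.f *ᵥ ψ.u))

/-- The coefficients of the most general Lorentz covariant vector-valued Wick polynomial
`Q_1^{Fμ} = g ∑ w_a ψ̄_f γ^μ (q_{a f f'} + qt_{a f f'} γ⁵) ψ_{f'}` without derivatives (so that its
divergence has scaling dimension at most four, as `S_1^F` has).  Charge conservation is not
presupposed. -/
structure FermiCurrent where
  q : Fin 4 → Lepton → Lepton → ℂ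
  qt : Fin 4 → Lepton → Lepton → ℂ

/-- The matrix elements of `Q_1^{Fμ}(x,l)` at `x = 0`, on the tangent vector `t`. -/
def Q1F (P : Params) (Q : FermiCurrent) (l t : Fin 4 → ℝ) (y : BosonLeg) (ψb ψ : FermionLeg)
    (μ : Fin 4) : ℂ :=
  (P.g : ℂ) * y.w l t * (ψb.u ⬝ᵥ
    ((gam μ * (Q.q y.a ψb.f ψ.f • 1 + Q.qt y.a ψb.f ψ.f • gam5)) *ᵥ ψ.u))

/-- String independence at first order: `d_l S_1^F = ∂_μ Q_1^{Fμ}`.  The differential `d_l` is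
evaluated on tangent vectors `t` of the light cone, and `∂_μ` multiplies by `-i` times the total
momentum. (The terms with the pointlike higgs field have `d_l = 0` and do not occur in `Q_1^F`.) -/
def FirstOrder (P : Params) (κ : Couplings) (Q : FermiCurrent) : Prop :=
  ∀ (l t : Fin 4 → ℝ) (y : BosonLeg) (ψb ψ : FermionLeg), IsString l → mdot l t = 0 →
    y.OnShell P l → ψb.OnShellBar P → ψ.OnShell P →
    lineDeriv ℝ (fun l' => S1F P κ l' (.gauge y) ψb ψ) l t
      = ∑ μ, (eta μ : ℂ) * (-I * ((y.k μ + ψb.k μ + ψ.k μ : ℝ) : ℂ)) * Q1F P Q l t y ψb ψ μ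

/-! ## Second order, tree graphs

The bosonic vector `Q_1^B` that belongs to the self-coupling of the bosons is

`Q_1^{Bμ} = 2 g ∑ f_{abc} F_a^{μλ} A_{cλ} w_b`
`  + g ∑' f_{abc} (m_a² + m_c² - m_b²) (A_a - ∂φ_a)^μ φ_c w_b`
`  + g ∑ (m_b² / 2 m_W) (φ_4 (∂φ_b - A_b)^μ - ∂^μ φ_4 φ_b) w_b`,

where `∑'` is over all `a, b, c` for which the escort fields in the summand exist, and the last sum
is over the massive vector bosons (`m_Z² / 2 m_W = m_Z / 2 cos Θ`).  There are further terms without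
contractions with `S_1^F`. -/

/-- Coefficient of `(A_a - ∂φ_a)^μ φ_c w_b`. -/
def escortCoeff (P : Params) (a b c : Fin 4) : ℝ :=
  if a = 3 ∨ c = 3 then 0
  else P.f a b c * (P.mass a ^ 2 + P.mass c ^ 2 - P.mass b ^ 2)

/-- Coefficient of `(φ_4 (∂φ_b - A_b)^μ - ∂^μ φ_4 φ_b) w_b`. -/
def higgsCoeff (P : Params) (b : Fin 4) : ℝ := P.mass b ^ 2 / (2 * P.mW)

/-- `𝒪(C_a, A'_{aκ}) ψ̄_f (⋯)^κ ψ_{f'} + 𝒪(C_a, φ_a') ψ̄_f (⋯) ψ_{f'}` (spinor matrix): the field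
`C_a^μ` contracted with the fields in `S_1^F`.  Different species have no contractions. -/
def contract (P : Params) (κ : Couplings) (c : Renorm) (l : Fin 4 → ℝ) (a : Fin 4) (V : VField)
    (f f' : Lepton) (p : Fin 4 → ℝ) : Matrix (Fin 4) (Fin 4) ℂ :=
  (∑ ρ, ((eta ρ : ℂ) * obs P c a V (.A ρ) p l) • κ.vec a f f' ρ)
    + obs P c a V .phi p l • κ.scal a f f'

/-- Crossings of `Q_1^B` (the factor `w_b` left out) with `S_1^F`.  The uncontracted boson field of
`Q_1^B` besides `w_b` is evaluated on `X`. -/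
def crossB (P : Params) (κ : Couplings) (c : Renorm) (l : Fin 4 → ℝ) (b : Fin 4) (X : ExtBoson)
    (f f' : Lepton) (p : Fin 4 → ℝ) : Matrix (Fin 4) (Fin 4) ℂ :=
  match X with
  | .gauge y =>
      (∑ a, ∑ lam, ((2 * P.f a b y.a * eta lam : ℝ) * y.A l lam)
        • contract P κ c l a (.F lam) f f' p)
      + (∑ a, ((escortCoeff P a b y.a : ℂ) * y.phi l)
        • (contract P κ c l a .A f f' p - contract P κ c l a .dphi f f' p))
      - (if b = y.a then (higgsCoeff P b : ℂ) * y.phi l * obsHiggs P p else 0) • κ.higgs f f'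
  | .higgs _ =>
      (higgsCoeff P b : ℂ) • (contract P κ c l b .dphi f f' p - contract P κ c l b .A f f' p)

/-- Crossings of `Q_1^F` (the factor `w_b` left out) with `S_1^F` in which the `ψ` of `Q_1^F` is
contracted; here `γ^μ (q + qt γ⁵) ψ = (q - qt γ⁵) γ^μ ψ`. -/
def crossR (P : Params) (κ : Couplings) (Q : FermiCurrent) (l : Fin 4 → ℝ) (b : Fin 4)
    (X : ExtBoson) (f f' : Lepton) (p : Fin 4 → ℝ) : Matrix (Fin 4) (Fin 4) ℂ :=
  ∑ h : Lepton, (Q.q b f h • 1 - Q.qt b f h • gam5) * obsRight (P.lmass h) p * vertex κ l X h f'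

/-- Crossings of `Q_1^F` (the factor `w_b` left out) with `S_1^F` in which the `ψ̄` of `Q_1^F` is
contracted. -/
def crossL (P : Params) (κ : Couplings) (Q : FermiCurrent) (l : Fin 4 → ℝ) (b : Fin 4)
    (X : ExtBoson) (f f' : Lepton) (p : Fin 4 → ℝ) : Matrix (Fin 4) (Fin 4) ℂ :=
  ∑ h : Lepton, vertex κ l X f h * obsLeft (P.lmass h) p * (Q.q b h f' • 1 + Q.qt b h f' • gam5)

/-- The sum of all crossings of `Q_1^μ(x,l)` with `S_1^F(x',l)`, where `w` is evaluated on `y` and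
the other uncontracted boson field on `X`.  This is a Fourier transform with respect to `x` and
`x'`, and `R` is the variable that belongs to `x`; the variable `p` of a two-point function is then
`R` minus the momenta of the uncontracted fields at `x`. -/
def crossings (P : Params) (κ : Couplings) (Q : FermiCurrent) (c : Renorm) (l t : Fin 4 → ℝ)
    (y : BosonLeg) (X : ExtBoson) (ψb ψ : FermionLeg) (R : Fin 4 → ℝ) : ℂ :=
  (P.g : ℂ) ^ 2 * y.w l t * (ψb.u ⬝ᵥ
    ((crossB P κ c l y.a X ψb.f ψ.f (R - y.k - X.mom)
      + crossR P κ Q l y.a X ψb.f ψ.f (R - y.k - ψb.k)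
      + crossL P κ Q l y.a X ψb.f ψ.f (R - y.k - ψ.k)) *ᵥ ψ.u))

/-- As `crossings`, with all ways to distribute the two external bosons over the two uncontracted
boson fields. -/
def crossingsSym (P : Params) (κ : Couplings) (Q : FermiCurrent) (c : Renorm) (l t : Fin 4 → ℝ)
    (y : BosonLeg) (X : ExtBoson) (ψb ψ : FermionLeg) (R : Fin 4 → ℝ) : ℂ :=
  crossings P κ Q c l t y X ψb ψ R +
    match X with
    | .gauge x => crossings P κ Q c l t x (.gauge y) ψb ψ R
    | .higgs _ => 0

/-- Total momentum of the external particles. -/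
def totalMom (y : BosonLeg) (X : ExtBoson) (ψb ψ : FermionLeg) : Fin 4 → ℝ :=
  y.k + X.mom + ψb.k + ψ.k

/-- `p` is away from the singularities of the two-point functions. -/
def Regular (P : Params) (l p : Fin 4 → ℝ) : Prop :=
  mdot p l ≠ 0 ∧ mdot p p ≠ P.mH ^ 2 ∧ (∀ a, mdot p p ≠ P.mass a ^ 2) ∧
    ∀ f, mdot p p ≠ P.lmass f ^ 2

/-- All two-point functions in `crossingsSym` are taken at regular points. -/
def RegularAt (P : Params) (l : Fin 4 → ℝ) (y : BosonLeg) (X : ExtBoson) (ψb ψ : FermionLeg)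
    (R : Fin 4 → ℝ) : Prop :=
  Regular P l (R - y.k - X.mom) ∧
    Regular P l (R - y.k - ψb.k) ∧ Regular P l (R - y.k - ψ.k) ∧
    Regular P l (R - X.mom - ψb.k) ∧ Regular P l (R - X.mom - ψ.k)

/-- Absence of obstructions to string independence at second order, in the tree graphs with two
external leptons: the sum of the crossings of `Q_1(x)` with `S_1^F(x')` and of `Q_1(x')` with
`S_1^F(x)` vanishes.  (If `R` belongs to `x`, then the total momentum minus `R` belongs to `x'`.)
The other two-point obstructions, which involve neither the factors `w` nor divergences, contain
further free parameters of the time ordering and yield no condition. -/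
def SecondOrder (P : Params) (κ : Couplings) (Q : FermiCurrent) (c : Renorm) : Prop :=
  ∀ (l t : Fin 4 → ℝ) (y : BosonLeg) (X : ExtBoson) (ψb ψ : FermionLeg) (R : Fin 4 → ℝ),
    IsString l → mdot l t = 0 → y.OnShell P l → X.OnShell P l → ψb.OnShellBar P → ψ.OnShell P →
    RegularAt P l y X ψb ψ R → RegularAt P l y X ψb ψ (totalMom y X ψb ψ - R) →
    crossingsSym P κ Q c l t y X ψb ψ R
      + crossingsSym P κ Q c l t y X ψb ψ (totalMom y X ψb ψ - R) = 0

/-- No obstructions to string independence at tree level up to second order, for some `Q_1^F` and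
some time ordering. -/
def StringIndependent (P : Params) (κ : Couplings) : Prop :=
  ∃ Q : FermiCurrent, FirstOrder P κ Q ∧ ∃ c : Renorm, SecondOrder P κ Q c

end StringLocal

end

open Complex Matrix

noncomputable section

namespace StringLocal

/-! ## Dirac algebra -/

/-! The external momenta in `FirstOrder` and `SecondOrder` are free, so one string direction, one
tangent vector and a few well-chosen momenta already determine the couplings. On-shell spinors for
two momenta of each lepton span all spinors (`eq_zero_of_onShell`), which turns every condition into
an equation between 4×4 matrices.

At first order the string derivative turns `A` into the boson momentum and the escort field into a
constant, while the Dirac equations turn the divergence of the current into mass terms. Hence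
`Q_1^F` repeats the vector couplings, and the escort couplings are `I` times mass differences and
mass sums times the vector and axial couplings (`FirstOrder.coeffs`). The photon has no escort, so
its axial coupling to the electron vanishes.

At second order the combinations of two-point obstructions that occur are constants in momentum
space, up to two kinds of terms. Those along `l` vanish because `l·A = 0`. The renormalization
contributes an unknown function of `(pl)`, linear in `p` and skew; neither `(pl)` nor this
contribution changes when `p` is shifted along the external `A` (`renormDiv_add_smul`). Momenta
differing only by such shifts therefore see unknown constants (`SecondOrder.matrix`). Diagonal
entries in the chiral representation are free of the unknowns (`SecondOrder.scalar`,
`SecondOrder.higgs_chir`); off-diagonal entries give commutation relations with constants common to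
both chiralities (`SecondOrder.vector`).

The decisive algebra is in `chirality_algebra`. By the commutation relations, the differences of the
Z couplings of the two chiralities are opposite for `e` and `ν`. Let `δ` be the one for `e`, times
`2 cos Θ`. If both chiralities coupled to `W`, the escort equations and `m_e² ≠ m_ν²` would force
both `δ = 1` and `δ = -1`. So exactly one chirality couples; the other coefficients then follow
successively, the higgs equations fixing the modulus of `b1`. Hermiticity enters through `b2` being
the conjugate of `b1`. -/

theorem slash_eq (p : Fin 4 → ℝ) : slash p =
    !![0, 0, (p 0 : ℂ) - p 3, -(p 1 : ℂ) + I * p 2; 0, 0, -(p 1 : ℂ) - I * p 2, (p 0 : ℂ) + p 3;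
      (p 0 : ℂ) + p 3, (p 1 : ℂ) - I * p 2, 0, 0; (p 1 : ℂ) + I * p 2, (p 0 : ℂ) - p 3, 0, 0] := by
  ext i j
  fin_cases i <;> fin_cases j <;>
    simp [slash, gam, eta, Fin.sum_univ_four, Matrix.add_apply] <;> ring

theorem gam5_eq : gam5 = !![-1, 0, 0, 0; 0, -1, 0, 0; 0, 0, 1, 0; 0, 0, 0, 1] := by
  ext i j
  fin_cases i <;> fin_cases j <;>
    simp [gam5, gam, Matrix.vecHead, Matrix.vecTail]

theorem slash_mul_slash (p : Fin 4 → ℝ) :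
    slash p * slash p = ((mdot p p : ℝ) : ℂ) • (1 : Matrix (Fin 4) (Fin 4) ℂ) := by
  rw [slash_eq]
  ext i j
  fin_cases i <;> fin_cases j <;>
    simp [mdot, eta, Matrix.mul_apply, Fin.sum_univ_four] <;>
    ring_nf <;> simp <;> ring

theorem slash_neg (p : Fin 4 → ℝ) : slash (-p) = -slash p := by
  simp [slash, Finset.sum_neg_distrib]

theorem slash_sub (p q : Fin 4 → ℝ) : slash (p - q) = slash p - slash q := by
  simp [slash, mul_sub, sub_smul, Finset.sum_sub_distrib]

/-- `diracT0 m p` is `I` times the inverse of `slash p - m`, and the two terms of the obstruction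
combine to `I • (slash p - m)` acting on it. What remains is a multiple of the delta function. -/
theorem obsRight_eq (m : ℝ) (p : Fin 4 → ℝ) (h : mdot p p ≠ m ^ 2) : obsRight m p = -1 := by
  have h' : ((mdot p p - m ^ 2 : ℝ) : ℂ) ≠ 0 := by exact_mod_cast sub_ne_zero.2 h
  have e : obsRight m p = ((-I * (m : ℂ)) • 1 + I • slash p) * diracT0 m p := by
    rw [obsRight, add_mul, Matrix.smul_mul, Matrix.one_mul, Matrix.smul_mul, slash, Finset.sum_mul,
      Finset.smul_sum, sub_eq_add_neg, ← Finset.sum_neg_distrib]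
    congr 1
    refine Finset.sum_congr rfl fun μ _ => ?_
    rw [Matrix.smul_mul, smul_smul, ← neg_smul]
    congr 1
    ring
  rw [e, diracT0, Matrix.mul_smul, add_mul, mul_add, mul_add]
  simp only [Matrix.smul_mul, Matrix.mul_smul, Matrix.one_mul, Matrix.mul_one, slash_mul_slash]
  have hP : I / ((mdot p p - m ^ 2 : ℝ) : ℂ) * (I * (((mdot p p : ℝ) : ℂ) - m ^ 2)) = -1 := by
    push_cast at h' ⊢
    field_simp
    simp
  rw [← neg_one_smul ℂ (1 : Matrix (Fin 4) (Fin 4) ℂ), ← hP]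
  module

theorem obsLeft_eq (m : ℝ) (p : Fin 4 → ℝ) (h : mdot p p ≠ m ^ 2) : obsLeft m p = 1 := by
  have h' : ((mdot p p - m ^ 2 : ℝ) : ℂ) ≠ 0 := by exact_mod_cast sub_ne_zero.2 h
  have hm : mdot (-p) (-p) = mdot p p := by simp [mdot]
  have e : obsLeft m p = diracT0 m (-p) * ((I * (m : ℂ)) • 1 + I • slash p) := by
    rw [obsLeft, mul_add, Matrix.mul_smul, Matrix.mul_one, Matrix.mul_smul, slash, Finset.mul_sum,
      Finset.smul_sum, sub_eq_add_neg, ← Finset.sum_neg_distrib]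
    congr 1
    refine Finset.sum_congr rfl fun μ _ => ?_
    rw [Matrix.mul_smul, smul_smul, ← neg_smul]
    congr 1
    ring
  rw [e, diracT0, hm, slash_neg, Matrix.smul_mul, add_mul, mul_add, mul_add]
  simp only [Matrix.smul_mul, Matrix.mul_smul, Matrix.one_mul, Matrix.mul_one, Matrix.neg_mul,
    slash_mul_slash]
  have hP : I / ((mdot p p - m ^ 2 : ℝ) : ℂ) * -(I * (((mdot p p : ℝ) : ℂ) - m ^ 2)) = 1 := by
    push_cast at h' ⊢
    field_simp
    simp
  calc _ = (I / ((mdot p p - m ^ 2 : ℝ) : ℂ) * -(I * (((mdot p p : ℝ) : ℂ) - m ^ 2)))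
        • (1 : Matrix (Fin 4) (Fin 4) ℂ) := by module
    _ = 1 := by rw [hP, one_smul]

theorem obsHiggs_eq (P : Params) (p : Fin 4 → ℝ) (h : mdot p p ≠ P.mH ^ 2) :
    obsHiggs P p = I := by
  have h' : ((mdot p p - P.mH ^ 2 : ℝ) : ℂ) ≠ 0 := by exact_mod_cast sub_ne_zero.2 h
  have hs : ∑ μ, (eta μ : ℂ) * (-I * (p μ : ℂ)) * (-I * (p μ : ℂ) * higgsT0 P p)
      = -((mdot p p : ℝ) : ℂ) * higgsT0 P p := by
    simp only [mdot]
    push_cast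
    rw [← Finset.sum_neg_distrib, Finset.sum_mul]
    refine Finset.sum_congr rfl fun μ _ => ?_
    linear_combination (eta μ : ℂ) * p μ * p μ * higgsT0 P p * I_mul_I
  rw [obsHiggs, hs, higgsT0]
  push_cast at h' ⊢
  field_simp
  ring

/-! ## Spinors -/

/-- The range of `slash k + m` consists of solutions of the Dirac equation, so `w` is a left
eigenvector of `slash k`, and likewise of `slash k'`, with eigenvalue `-m`. Then `slash (k - k')`
annihilates `w`, and its square is a nonzero scalar. In other words, the solutions for the two
momenta span all spinors. -/
theorem eq_zero_of_dotProduct_dirac {m : ℝ} {k k' : Fin 4 → ℝ} (hk : mdot k k = m ^ 2)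
    (hk' : mdot k' k' = m ^ 2) (hd : mdot (k - k') (k - k') ≠ 0) {w : Fin 4 → ℂ}
    (h : ∀ u, slash k *ᵥ u = (m : ℂ) • u → w ⬝ᵥ u = 0)
    (h' : ∀ u, slash k' *ᵥ u = (m : ℂ) • u → w ⬝ᵥ u = 0) : w = 0 := by
  have key : ∀ q : Fin 4 → ℝ, mdot q q = m ^ 2 →
      (∀ u, slash q *ᵥ u = (m : ℂ) • u → w ⬝ᵥ u = 0) → w ᵥ* slash q = -(m : ℂ) • w := by
    intro q hq hu
    have h0 : w ᵥ* (slash q + (m : ℂ) • 1) = 0 := by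
      refine dotProduct_eq_zero _ fun v => ?_
      rw [← dotProduct_mulVec]
      refine hu _ ?_
      rw [mulVec_mulVec, mul_add, slash_mul_slash, hq, ← smul_mulVec]
      congr 1
      rw [Matrix.mul_smul, Matrix.mul_one]
      push_cast
      module
    rw [vecMul_add, vecMul_smul, vecMul_one] at h0
    rw [neg_smul]
    exact eq_neg_of_add_eq_zero_left h0
  have h1 : w ᵥ* slash (k - k') = 0 := by
    rw [slash_sub, vecMul_sub, key k hk h, key k' hk' h', sub_self]
  have h2 : ((mdot (k - k') (k - k') : ℝ) : ℂ) • w = 0 := by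
    rw [← vecMul_one (((mdot (k - k') (k - k') : ℝ) : ℂ) • w), smul_vecMul, ← vecMul_smul,
      ← slash_mul_slash, ← vecMul_vecMul, h1, zero_vecMul]
  exact (smul_eq_zero.1 h2).resolve_left (by exact_mod_cast hd)

theorem eq_zero_of_dirac_dotProduct {m : ℝ} {k k' : Fin 4 → ℝ} (hk : mdot k k = m ^ 2)
    (hk' : mdot k' k' = m ^ 2) (hd : mdot (k - k') (k - k') ≠ 0) {w : Fin 4 → ℂ}
    (h : ∀ u, u ᵥ* slash k = -(m : ℂ) • u → u ⬝ᵥ w = 0)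
    (h' : ∀ u, u ᵥ* slash k' = -(m : ℂ) • u → u ⬝ᵥ w = 0) : w = 0 := by
  have key : ∀ q : Fin 4 → ℝ, mdot q q = m ^ 2 →
      (∀ u, u ᵥ* slash q = -(m : ℂ) • u → u ⬝ᵥ w = 0) → slash q *ᵥ w = (m : ℂ) • w := by
    intro q hq hu
    have h0 : (slash q - (m : ℂ) • 1) *ᵥ w = 0 := by
      refine dotProduct_eq_zero _ fun v => ?_
      rw [dotProduct_comm, dotProduct_mulVec]
      refine hu _ ?_
      rw [vecMul_vecMul, sub_mul, slash_mul_slash, hq, ← vecMul_smul]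
      congr 1
      rw [Matrix.smul_mul, Matrix.one_mul]
      push_cast
      module
    rw [sub_mulVec, smul_mulVec, one_mulVec] at h0
    exact sub_eq_zero.1 h0
  have h1 : slash (k - k') *ᵥ w = 0 := by
    rw [slash_sub, sub_mulVec, key k hk h, key k' hk' h', sub_self]
  have h2 : ((mdot (k - k') (k - k') : ℝ) : ℂ) • w = 0 := by
    rw [← one_mulVec (((mdot (k - k') (k - k') : ℝ) : ℂ) • w), mulVec_smul, ← smul_mulVec,
      ← slash_mul_slash, ← mulVec_mulVec, h1, mulVec_zero]
  exact (smul_eq_zero.1 h2).resolve_left (by exact_mod_cast hd)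

/-- A spinor matrix vanishes if its matrix elements do between on-shell spinors, for two momenta
of each lepton with a non-lightlike difference. -/
theorem eq_zero_of_onShell {P : Params} {f f' : Lepton} {Γ : Matrix (Fin 4) (Fin 4) ℂ}
    {k₁ k₂ : Bool → Fin 4 → ℝ}
    (hk₁ : ∀ i, mdot (k₁ i) (k₁ i) = P.lmass f ^ 2) (hk₂ : ∀ i, mdot (k₂ i) (k₂ i) = P.lmass f' ^ 2)
    (hd₁ : mdot (k₁ true - k₁ false) (k₁ true - k₁ false) ≠ 0)
    (hd₂ : mdot (k₂ true - k₂ false) (k₂ true - k₂ false) ≠ 0)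
    (h : ∀ i j ub u, ub ᵥ* slash (k₁ i) = -(P.lmass f : ℂ) • ub →
      slash (k₂ j) *ᵥ u = (P.lmass f' : ℂ) • u → ub ⬝ᵥ (Γ *ᵥ u) = 0) : Γ = 0 := by
  have h1 : ∀ i ub, ub ᵥ* slash (k₁ i) = -(P.lmass f : ℂ) • ub → ub ᵥ* Γ = 0 := fun i ub hub =>
    eq_zero_of_dotProduct_dirac (hk₂ true) (hk₂ false) hd₂
      (fun u hu => by rw [← dotProduct_mulVec]; exact h i true ub u hub hu)
      (fun u hu => by rw [← dotProduct_mulVec]; exact h i false ub u hub hu)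
  have h2 : ∀ v, Γ *ᵥ v = 0 := fun v =>
    eq_zero_of_dirac_dotProduct (hk₁ true) (hk₁ false) hd₁
      (fun u hu => by rw [dotProduct_mulVec, h1 true u hu, zero_dotProduct])
      (fun u hu => by rw [dotProduct_mulVec, h1 false u hu, zero_dotProduct])
  exact Matrix.ext_of_mulVec_single fun i => by rw [h2, zero_mulVec]

/-! ## Obstructions of the boson fields -/

theorem cdot_single (l : Fin 4 → ℝ) (ρ : Fin 4) :
    cdot l (Pi.single ρ 1) = (eta ρ : ℂ) * (l ρ : ℂ) := by
  simp [cdot, Pi.single_apply]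

/-- The part `p p / m²` of the polarization sum factorizes. For `m = 0` the quotient is zero by
convention, in agreement with `polSum`, so massive and massless fields share one formula. -/
theorem Mfun_eq (m : ℝ) (X Y : BField) (p l : Fin 4 → ℝ) : Mfun m X Y p l =
    -(∑ ρ, (eta ρ : ℂ) * annih X p l (Pi.single ρ 1)
        * (starRingEnd ℂ) (annih Y p l (Pi.single ρ 1)))
      + (∑ ρ, (p ρ : ℂ) * annih X p l (Pi.single ρ 1))
        * (∑ ρ, (p ρ : ℂ) * (starRingEnd ℂ) (annih Y p l (Pi.single ρ 1))) / (m : ℂ) ^ 2 := by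
  have hp : ∀ ρ σ, ((polSum m p ρ σ : ℝ) : ℂ)
      = (if ρ = σ then -(eta ρ : ℂ) else 0) + (p ρ : ℂ) * p σ / (m : ℂ) ^ 2 := by
    intro ρ σ
    simp only [polSum]
    by_cases hm : m = 0 <;> by_cases h : ρ = σ <;> simp [hm, h]
  simp only [Mfun, hp, add_mul, Finset.sum_add_distrib, ite_mul, zero_mul, Finset.sum_ite_eq,
    Finset.mem_univ, if_true, neg_mul, Finset.sum_neg_distrib]
  congr 1
  rw [Finset.sum_mul_sum, Finset.sum_div]
  refine Finset.sum_congr rfl fun ρ _ => ?_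
  rw [Finset.sum_div]
  refine Finset.sum_congr rfl fun σ _ => ?_
  ring

theorem sum_eta_mul_mul (p q : Fin 4 → ℝ) :
    ∑ ρ, (eta ρ : ℂ) * (p ρ : ℂ) * (q ρ : ℂ) = ((mdot p q : ℝ) : ℂ) := by
  simp [mdot]

theorem eta_mul_eta (ρ : Fin 4) : (eta ρ : ℂ) * (eta ρ : ℂ) = 1 := by
  by_cases h : ρ = 0 <;> simp [eta, h]

theorem conj_annih_phi_single (p l : Fin 4 → ℝ) (ρ : Fin 4) :
    (starRingEnd ℂ) (annih .phi p l (Pi.single ρ 1))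
      = I * ((eta ρ : ℂ) * (l ρ : ℂ) / ((mdot p l : ℝ) : ℂ)) := by
  simp [annih, cdot_single]

theorem conj_annih_A_single (p l : Fin 4 → ℝ) (κ ρ : Fin 4) :
    (starRingEnd ℂ) (annih (.A κ) p l (Pi.single ρ 1))
      = (if κ = ρ then 1 else 0)
        - (p κ : ℂ) * ((eta ρ : ℂ) * (l ρ : ℂ) / ((mdot p l : ℝ) : ℂ)) := by
  by_cases h : κ = ρ <;> simp [annih, cdot_single, h]

theorem sum_mul_conj_annih_phi {p l : Fin 4 → ℝ} (hpl : mdot p l ≠ 0) :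
    ∑ ρ, (p ρ : ℂ) * (starRingEnd ℂ) (annih .phi p l (Pi.single ρ 1)) = I := by
  have h' : ((mdot p l : ℝ) : ℂ) ≠ 0 := by exact_mod_cast hpl
  have : ∀ ρ, (p ρ : ℂ) * (starRingEnd ℂ) (annih .phi p l (Pi.single ρ 1))
      = I / ((mdot p l : ℝ) : ℂ) * ((eta ρ : ℂ) * (p ρ : ℂ) * (l ρ : ℂ)) := fun ρ => by
    rw [conj_annih_phi_single]; ring
  rw [Finset.sum_congr rfl fun ρ _ => this ρ, ← Finset.mul_sum, sum_eta_mul_mul,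
    div_mul_cancel₀ _ h']

/-- The intertwiner of `A` annihilates the polarization `p`, so the part of the polarization sum
with `m²` in the denominator drops out against a string-local potential. -/
theorem sum_mul_conj_annih_A {p l : Fin 4 → ℝ} (hpl : mdot p l ≠ 0) (κ : Fin 4) :
    ∑ ρ, (p ρ : ℂ) * (starRingEnd ℂ) (annih (.A κ) p l (Pi.single ρ 1)) = 0 := by
  have h' : ((mdot p l : ℝ) : ℂ) ≠ 0 := by exact_mod_cast hpl
  have : ∀ ρ, (p ρ : ℂ) * (starRingEnd ℂ) (annih (.A κ) p l (Pi.single ρ 1))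
      = (if κ = ρ then (p ρ : ℂ) else 0)
        - (p κ : ℂ) / ((mdot p l : ℝ) : ℂ) * ((eta ρ : ℂ) * (p ρ : ℂ) * (l ρ : ℂ)) := fun ρ => by
    rw [conj_annih_A_single, mul_sub, mul_ite, mul_one, mul_zero]; ring
  rw [Finset.sum_congr rfl fun ρ _ => this ρ, Finset.sum_sub_distrib, ← Finset.mul_sum,
    sum_eta_mul_mul, div_mul_cancel₀ _ h', Finset.sum_ite_eq, if_pos (Finset.mem_univ _), sub_self]

/-- Subtracting the gradient of the escort field removes the string from the potential: the
intertwiner of the Proca field `A - ∂φ` is the polarization itself. -/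
theorem Mfun_A_sub_dphi (m : ℝ) (Y : BField) (p l : Fin 4 → ℝ) (μ : Fin 4) :
    Mfun m (.A μ) Y p l - Mfun m (.dphi μ) Y p l
      = -((eta μ : ℂ) * (starRingEnd ℂ) (annih Y p l (Pi.single μ 1)))
        + (p μ : ℂ) * (∑ ρ, (p ρ : ℂ) * (starRingEnd ℂ) (annih Y p l (Pi.single ρ 1)))
          / (m : ℂ) ^ 2 := by
  have h : ∀ ρ, annih (.A μ) p l (Pi.single ρ 1) - annih (.dphi μ) p l (Pi.single ρ 1)
      = if μ = ρ then 1 else 0 := by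
    intro ρ
    simp only [annih, Pi.single_apply]
    linear_combination (-(p μ : ℂ)) * (cdot l (Pi.single ρ 1) / ((mdot p l : ℝ) : ℂ)) * I_mul_I
  rw [Mfun_eq, Mfun_eq, add_sub_add_comm, ← sub_div, ← sub_mul, ← Finset.sum_sub_distrib,
    neg_sub_neg, ← neg_sub, ← Finset.sum_sub_distrib]
  simp only [← sub_mul, ← mul_sub, h]
  simp

theorem Mfun_F (m : ℝ) (Y : BField) (p l : Fin 4 → ℝ) (μ ν : Fin 4) :
    Mfun m (.F μ ν) Y p l
      = -I * ((p μ : ℂ) * (Mfun m (.A ν) Y p l - Mfun m (.dphi ν) Y p l)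
          - (p ν : ℂ) * (Mfun m (.A μ) Y p l - Mfun m (.dphi μ) Y p l)) := by
  simp only [Mfun, ← Finset.sum_sub_distrib, Finset.mul_sum]
  refine Finset.sum_congr rfl fun ρ _ => Finset.sum_congr rfl fun σ _ => ?_
  simp only [annih]
  ring

theorem Mfun_A_sub_dphi_A (m : ℝ) {p l : Fin 4 → ℝ} (hpl : mdot p l ≠ 0) (μ κ : Fin 4) :
    Mfun m (.A μ) (.A κ) p l - Mfun m (.dphi μ) (.A κ) p l
      = (if κ = μ then -(eta μ : ℂ) else 0) + (l μ : ℂ) * (p κ : ℂ) / ((mdot p l : ℝ) : ℂ) := by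
  rw [Mfun_A_sub_dphi, sum_mul_conj_annih_A hpl, conj_annih_A_single]
  by_cases h : κ = μ
  · simp only [h, if_true]
    linear_combination (l μ : ℂ) * (p μ : ℂ) / ((mdot p l : ℝ) : ℂ) * eta_mul_eta μ
  · simp only [h, if_false]
    linear_combination (l μ : ℂ) * (p κ : ℂ) / ((mdot p l : ℝ) : ℂ) * eta_mul_eta μ

theorem Mfun_A_sub_dphi_phi (m : ℝ) {p l : Fin 4 → ℝ} (hpl : mdot p l ≠ 0) (μ : Fin 4) :
    Mfun m (.A μ) .phi p l - Mfun m (.dphi μ) .phi p l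
      = -I * (l μ : ℂ) / ((mdot p l : ℝ) : ℂ) + I * (p μ : ℂ) / (m : ℂ) ^ 2 := by
  rw [Mfun_A_sub_dphi, sum_mul_conj_annih_phi hpl, conj_annih_phi_single]
  linear_combination -I * (l μ : ℂ) / ((mdot p l : ℝ) : ℂ) * eta_mul_eta μ

/-- The string term `l p / (pl)` compensates the divergence of `-g` for all `p`, also off the mass
shell. -/
theorem sum_eta_mul_Mfun_A {m : ℝ} {p l : Fin 4 → ℝ} (hpl : mdot p l ≠ 0) (κ : Fin 4) :
    ∑ μ, (eta μ : ℂ) * (p μ : ℂ) * (Mfun m (.A μ) (.A κ) p l - Mfun m (.dphi μ) (.A κ) p l) = 0 := by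
  have h' : ((mdot p l : ℝ) : ℂ) ≠ 0 := by exact_mod_cast hpl
  have : ∀ μ, (eta μ : ℂ) * (p μ : ℂ)
        * (Mfun m (.A μ) (.A κ) p l - Mfun m (.dphi μ) (.A κ) p l)
      = (if κ = μ then -(p μ : ℂ) else 0)
        + (p κ : ℂ) / ((mdot p l : ℝ) : ℂ) * ((eta μ : ℂ) * (p μ : ℂ) * (l μ : ℂ)) := fun μ => by
    rw [Mfun_A_sub_dphi_A m hpl]
    by_cases h : κ = μ
    · simp only [h, if_true]
      linear_combination -(p μ : ℂ) * eta_mul_eta μ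
    · simp only [h, if_false]
      ring
  rw [Finset.sum_congr rfl fun μ _ => this μ, Finset.sum_add_distrib, ← Finset.mul_sum,
    sum_eta_mul_mul, div_mul_cancel₀ _ h', Finset.sum_ite_eq, if_pos (Finset.mem_univ _)]
  ring

theorem sum_eta_mul_Mfun_phi {m : ℝ} {p l : Fin 4 → ℝ} (hpl : mdot p l ≠ 0) :
    ∑ μ, (eta μ : ℂ) * (p μ : ℂ) * (Mfun m (.A μ) .phi p l - Mfun m (.dphi μ) .phi p l)
      = -I + I * ((mdot p p : ℝ) : ℂ) / (m : ℂ) ^ 2 := by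
  have h' : ((mdot p l : ℝ) : ℂ) ≠ 0 := by exact_mod_cast hpl
  have : ∀ μ, (eta μ : ℂ) * (p μ : ℂ) * (Mfun m (.A μ) .phi p l - Mfun m (.dphi μ) .phi p l)
      = -I / ((mdot p l : ℝ) : ℂ) * ((eta μ : ℂ) * (p μ : ℂ) * (l μ : ℂ))
        + I / (m : ℂ) ^ 2 * ((eta μ : ℂ) * (p μ : ℂ) * (p μ : ℂ)) := fun μ => by
    rw [Mfun_A_sub_dphi_phi m hpl]
    ring
  rw [Finset.sum_congr rfl fun μ _ => this μ, Finset.sum_add_distrib, ← Finset.mul_sum,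
    ← Finset.mul_sum, sum_eta_mul_mul, sum_eta_mul_mul, div_mul_cancel₀ _ h']
  ring

/-- Both divergences are `-m² φ` by the field equations and cancel; only the derivative of the
two-point function of the Proca field survives. -/
theorem obs_A_sub_dphi (P : Params) (c : Renorm) (a : Fin 4) (Y : BField) (p l : Fin 4 → ℝ) :
    obs P c a .A Y p l - obs P c a .dphi Y p l
      = I * (I / ((mdot p p - P.mass a ^ 2 : ℝ) : ℂ)) * ∑ μ, (eta μ : ℂ) * (p μ : ℂ)
        * (Mfun (P.mass a) (.A μ) Y p l - Mfun (P.mass a) (.dphi μ) Y p l) := by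
  rw [obs, obs]
  simp only [onShellDiv, VField.comp, TO, T0, add_zero]
  rw [sub_sub_sub_cancel_left, ← Finset.sum_sub_distrib, Finset.mul_sum]
  refine Finset.sum_congr rfl fun μ _ => ?_
  ring

theorem obs_A_sub_dphi_A (P : Params) (c : Renorm) (a κ : Fin 4) {p l : Fin 4 → ℝ}
    (hpl : mdot p l ≠ 0) : obs P c a .A (.A κ) p l - obs P c a .dphi (.A κ) p l = 0 := by
  rw [obs_A_sub_dphi, sum_eta_mul_Mfun_A hpl, mul_zero]

theorem obs_A_sub_dphi_phi (P : Params) (c : Renorm) {a : Fin 4} {p l : Fin 4 → ℝ}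
    (hpl : mdot p l ≠ 0) (hp : mdot p p ≠ P.mass a ^ 2) (ha : P.mass a ≠ 0) :
    obs P c a .A .phi p l - obs P c a .dphi .phi p l = -I / (P.mass a : ℂ) ^ 2 := by
  have h' : ((mdot p p - P.mass a ^ 2 : ℝ) : ℂ) ≠ 0 := by exact_mod_cast sub_ne_zero.2 hp
  have ha' : (P.mass a : ℂ) ≠ 0 := by exact_mod_cast ha
  rw [obs_A_sub_dphi, sum_eta_mul_Mfun_phi hpl]
  push_cast at h' ⊢
  field_simp
  simp only [I_sq]
  ring

/-- The contribution of the renormalization to `𝒪(F^{·λ}, A^κ)`. -/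
def renormDiv (c : Renorm) (a : Fin 4) (p l : Fin 4 → ℝ) (lam κ : Fin 4) : ℂ :=
  ∑ μ, (eta μ : ℂ) * (p μ : ℂ) * (c a l (mdot p l) μ lam κ - c a l (mdot p l) lam μ κ)

/-- `F` is the curl of the Proca field (`Mfun_F`), so its divergence produces `p²` times the Proca
function; with the mass term from the field equation this becomes `p² - m²` and cancels the
propagator. -/
theorem obs_F (P : Params) (c : Renorm) (a lam : Fin 4) (Y : BField) (p l : Fin 4 → ℝ)
    (hp : mdot p p ≠ P.mass a ^ 2) :
    obs P c a (.F lam) Y p l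
      = I * (Mfun (P.mass a) (.A lam) Y p l - Mfun (P.mass a) (.dphi lam) Y p l)
        - I / ((mdot p p - P.mass a ^ 2 : ℝ) : ℂ) * (p lam : ℂ) * (∑ μ, (eta μ : ℂ) * (p μ : ℂ)
          * (Mfun (P.mass a) (.A μ) Y p l - Mfun (P.mass a) (.dphi μ) Y p l))
        + match Y with
          | .A κ => I * renormDiv c a p l lam κ
          | _ => 0 := by
  have h' : ((mdot p p - P.mass a ^ 2 : ℝ) : ℂ) ≠ 0 := by exact_mod_cast sub_ne_zero.2 hp
  have key : onShellDiv (P.mass a) (.F lam) (fun X => T0 (P.mass a) X Y p l)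
      - ∑ μ, (eta μ : ℂ) * (-I * (p μ : ℂ)) * T0 (P.mass a) (.F μ lam) Y p l
      = I * (Mfun (P.mass a) (.A lam) Y p l - Mfun (P.mass a) (.dphi lam) Y p l)
        - I / ((mdot p p - P.mass a ^ 2 : ℝ) : ℂ) * (p lam : ℂ) * (∑ μ, (eta μ : ℂ) * (p μ : ℂ)
          * (Mfun (P.mass a) (.A μ) Y p l - Mfun (P.mass a) (.dphi μ) Y p l)) := by
    simp only [onShellDiv, T0, Mfun_F, ← mul_sub]
    set G : Fin 4 → ℂ := fun μ => Mfun (P.mass a) (.A μ) Y p l - Mfun (P.mass a) (.dphi μ) Y p l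
    have e : ∑ μ, (eta μ : ℂ) * (-I * (p μ : ℂ)) * (I / ((mdot p p - P.mass a ^ 2 : ℝ) : ℂ)
          * (-I * ((p μ : ℂ) * G lam - (p lam : ℂ) * G μ)))
        = -(I / ((mdot p p - P.mass a ^ 2 : ℝ) : ℂ)) * (((mdot p p : ℝ) : ℂ) * G lam
          - (p lam : ℂ) * ∑ μ, (eta μ : ℂ) * (p μ : ℂ) * G μ) := by
      rw [← sum_eta_mul_mul, Finset.sum_mul, Finset.mul_sum, ← Finset.sum_sub_distrib,
        Finset.mul_sum]
      refine Finset.sum_congr rfl fun μ _ => ?_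
      linear_combination (eta μ : ℂ) * (p μ : ℂ) * (I / ((mdot p p - P.mass a ^ 2 : ℝ) : ℂ))
        * ((p μ : ℂ) * G lam - (p lam : ℂ) * G μ) * I_mul_I
    change -(P.mass a : ℂ) ^ 2 * (I / ((mdot p p - P.mass a ^ 2 : ℝ) : ℂ) * G lam) - _ = I * G lam - _
    rw [e]
    have h2 : I / ((mdot p p - P.mass a ^ 2 : ℝ) : ℂ)
        * (((mdot p p : ℝ) : ℂ) - (P.mass a : ℂ) ^ 2) = I := by
      push_cast at h' ⊢
      field_simp
    linear_combination G lam * h2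
  cases Y with
  | A κ =>
    rw [← key, obs]
    simp only [VField.comp, TO, mul_add, Finset.sum_add_distrib, renormDiv, onShellDiv, add_zero,
      Finset.mul_sum]
    rw [← sub_sub, sub_eq_add_neg _ (∑ μ, (eta μ : ℂ) * (-I * (p μ : ℂ)) * _),
      ← Finset.sum_neg_distrib]
    congr 1
    refine Finset.sum_congr rfl fun μ _ => ?_
    ring
  | F μ ν => rw [← key, obs]; simp [VField.comp, TO, onShellDiv]
  | phi => rw [← key, obs]; simp [VField.comp, TO, onShellDiv]
  | dphi μ => rw [← key, obs]; simp [VField.comp, TO, onShellDiv]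

theorem obs_F_A (P : Params) (c : Renorm) (a lam κ : Fin 4) {p l : Fin 4 → ℝ}
    (hpl : mdot p l ≠ 0) (hp : mdot p p ≠ P.mass a ^ 2) :
    obs P c a (.F lam) (.A κ) p l
      = I * ((if κ = lam then -(eta lam : ℂ) else 0)
          + (l lam : ℂ) * (p κ : ℂ) / ((mdot p l : ℝ) : ℂ))
        + I * renormDiv c a p l lam κ := by
  rw [obs_F P c a lam _ p l hp, sum_eta_mul_Mfun_A hpl, Mfun_A_sub_dphi_A _ hpl]
  ring

theorem obs_F_phi (P : Params) (c : Renorm) (a lam : Fin 4) {p l : Fin 4 → ℝ}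
    (hpl : mdot p l ≠ 0) (hp : mdot p p ≠ P.mass a ^ 2) (ha : P.mass a ≠ 0) :
    obs P c a (.F lam) .phi p l = (l lam : ℂ) / ((mdot p l : ℝ) : ℂ) := by
  have h' : ((mdot p p - P.mass a ^ 2 : ℝ) : ℂ) ≠ 0 := by exact_mod_cast sub_ne_zero.2 hp
  have ha' : (P.mass a : ℂ) ≠ 0 := by exact_mod_cast ha
  rw [obs_F P c a lam _ p l hp, sum_eta_mul_Mfun_phi hpl, Mfun_A_sub_dphi_phi _ hpl]
  have h2 : I / ((mdot p p - P.mass a ^ 2 : ℝ) : ℂ)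
      * (-I + I * ((mdot p p : ℝ) : ℂ) / (P.mass a : ℂ) ^ 2) = -1 / (P.mass a : ℂ) ^ 2 := by
    push_cast at h' ⊢
    field_simp
    simp only [I_sq]
    ring
  linear_combination (-(p lam : ℂ)) * h2 + (p lam / (P.mass a : ℂ) ^ 2
    - (l lam : ℂ) / ((mdot p l : ℝ) : ℂ)) * I_mul_I

theorem scal_photon (κ : Couplings) (f f' : Lepton) : κ.scal 3 f f' = 0 := by
  cases f <;> cases f' <;> simp [Couplings.scal, realBasis]

theorem mass_ne_zero {P : Params} (hW : 0 < P.mW) (hZ : P.mW < P.mZ) {a : Fin 4} (ha : a ≠ 3) :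
    P.mass a ≠ 0 := by
  fin_cases a
  · exact hW.ne'
  · exact hW.ne'
  · exact (hW.trans hZ).ne'
  · exact absurd rfl ha

theorem contract_A_sub_dphi (P : Params) (κ : Couplings) (c : Renorm) {a : Fin 4}
    (ha : P.mass a ≠ 0) (f f' : Lepton) {p l : Fin 4 → ℝ} (hpl : mdot p l ≠ 0)
    (hp : mdot p p ≠ P.mass a ^ 2) :
    contract P κ c l a .A f f' p - contract P κ c l a .dphi f f' p
      = (-I / (P.mass a : ℂ) ^ 2) • κ.scal a f f' := by
  rw [contract, contract, add_sub_add_comm, ← Finset.sum_sub_distrib, ← sub_smul,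
    obs_A_sub_dphi_phi P c hpl hp ha]
  simp only [← sub_smul, ← mul_sub, obs_A_sub_dphi_A P c a _ hpl]
  simp

/-- The coefficients of `ψ̄γ^κψ` in the contraction of `F_a^{μλ} A_λ` with `A_{aκ} ψ̄γ^κψ`. -/
def faradayCoeff (c : Renorm) (a : Fin 4) (p l : Fin 4 → ℝ) (A : Fin 4 → ℂ) (κ : Fin 4) : ℂ :=
  I * (eta κ : ℂ) * (-A κ + ∑ lam, (eta lam : ℂ) * A lam * renormDiv c a p l lam κ)

/-- The nonlocal terms of `obs_F_A` and `obs_F_phi` point along `l` and disappear against `A`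
because `l·A = 0`. A local term and the renormalization are left. -/
theorem sum_contract_F (P : Params) (hM : ∀ a ≠ 3, P.mass a ≠ 0) (κ : Couplings) (c : Renorm)
    (a : Fin 4) (f f' : Lepton) {p l : Fin 4 → ℝ} (hpl : mdot p l ≠ 0)
    (hp : mdot p p ≠ P.mass a ^ 2) {A : Fin 4 → ℂ} (hA : cdot l A = 0) :
    ∑ lam, ((eta lam : ℂ) * A lam) • contract P κ c l a (.F lam) f f' p
      = ∑ ρ, faradayCoeff c a p l A ρ • κ.vec a f f' ρ := by
  have hs : ∀ lam, obs P c a (.F lam) .phi p l • κ.scal a f f'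
      = ((l lam : ℂ) / ((mdot p l : ℝ) : ℂ)) • κ.scal a f f' := fun lam => by
    by_cases ha : a = 3
    · subst ha
      simp [scal_photon]
    · rw [obs_F_phi P c a lam hpl hp (hM a ha)]
  simp only [contract, hs, smul_add, Finset.sum_add_distrib, smul_smul, Finset.smul_sum]
  have hl : ∀ z : ℂ, ∑ lam, (eta lam : ℂ) * A lam * ((l lam : ℂ) * z) = 0 := fun z => by
    rw [cdot] at hA
    calc _ = (∑ μ, (eta μ : ℂ) * (l μ : ℂ) * A μ) * z := by
          rw [Finset.sum_mul]
          exact Finset.sum_congr rfl fun μ _ => by ring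
      _ = 0 := by rw [hA, zero_mul]
  rw [← Finset.sum_smul, Finset.sum_comm]
  simp only [div_eq_mul_inv, hl, zero_smul, add_zero, ← Finset.sum_smul]
  refine Finset.sum_congr rfl fun ρ _ => ?_
  congr 1
  have h1 : ∀ lam, (eta lam : ℂ) * A lam * ((eta ρ : ℂ) * obs P c a (.F lam) (.A ρ) p l)
      = (if ρ = lam then -(I * (eta lam : ℂ) * A lam) else 0)
        + (eta lam : ℂ) * A lam * ((l lam : ℂ)
          * ((eta ρ : ℂ) * I * (p ρ : ℂ) / ((mdot p l : ℝ) : ℂ)))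
        + I * (eta ρ : ℂ) * ((eta lam : ℂ) * A lam * renormDiv c a p l lam ρ) := fun lam => by
    rw [obs_F_A P c a lam ρ hpl hp]
    by_cases h : ρ = lam
    · subst h
      simp only [if_true]
      linear_combination -(I * (eta ρ : ℂ) * A ρ) * eta_mul_eta ρ
    · simp only [h, if_false]
      ring
  rw [Finset.sum_congr rfl fun lam _ => h1 lam, Finset.sum_add_distrib, Finset.sum_add_distrib, hl,
    ← Finset.mul_sum, Finset.sum_ite_eq, if_pos (Finset.mem_univ _), faradayCoeff]
  ring

theorem cdot_legA {l : Fin 4 → ℝ} (y : BosonLeg) (hk : mdot y.k l ≠ 0) :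
    cdot l (y.A l) = 0 := by
  have h' : ((mdot y.k l : ℝ) : ℂ) ≠ 0 := by exact_mod_cast hk
  have e : ∀ μ, (eta μ : ℂ) * (l μ : ℂ) * y.A l μ = (eta μ : ℂ) * (l μ : ℂ) * y.e μ
      - (cdot l y.e / ((mdot y.k l : ℝ) : ℂ)) * ((eta μ : ℂ) * (y.k μ : ℂ) * (l μ : ℂ)) := fun μ => by
    simp only [BosonLeg.A, annih]
    ring
  rw [cdot, Finset.sum_congr rfl fun μ _ => e μ, Finset.sum_sub_distrib, ← Finset.mul_sum,
    sum_eta_mul_mul, div_mul_cancel₀ _ h', cdot, sub_self]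

theorem crossB_gauge (P : Params) (hM : ∀ a ≠ 3, P.mass a ≠ 0) (κ : Couplings) (c : Renorm)
    {l : Fin 4 → ℝ} (b : Fin 4) (x : BosonLeg) (hk : mdot x.k l ≠ 0)
    (f f' : Lepton) {p : Fin 4 → ℝ} (hp : Regular P l p) :
    crossB P κ c l b (.gauge x) f f' p
      = (∑ a, (2 * P.f a b x.a : ℂ) • ∑ ρ, faradayCoeff c a p l (x.A l) ρ • κ.vec a f f' ρ)
        + x.phi l • ((∑ a, ((escortCoeff P a b x.a : ℂ) * (-I / (P.mass a : ℂ) ^ 2))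
            • κ.scal a f f')
          - (if b = x.a then (higgsCoeff P b : ℂ) * I else 0) • κ.higgs f f') := by
  rw [crossB, obsHiggs_eq P p hp.2.1, smul_sub, Finset.smul_sum, ← add_sub_assoc]
  congr 1
  · congr 1
    · refine Finset.sum_congr rfl fun a _ => ?_
      rw [← sum_contract_F P hM κ c a f f' hp.1 (hp.2.2.1 a) (cdot_legA x hk), Finset.smul_sum]
      refine Finset.sum_congr rfl fun lam _ => ?_
      rw [smul_smul]
      congr 1
      push_cast
      ring
    · refine Finset.sum_congr rfl fun a _ => ?_
      by_cases ha : a = 3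
      · simp [escortCoeff, ha]
      · rw [contract_A_sub_dphi P κ c (hM a ha) f f' hp.1 (hp.2.2.1 a), smul_smul, smul_smul]
        congr 1
        ring
  · rw [smul_smul]
    congr 1
    split_ifs
    · ring
    · ring

/-- The factor `m_b²` of `higgsCoeff` cancels the `1 / m_b²` of the Proca–escort obstruction, so the
result is the same for all massive species. -/
theorem crossB_higgs (P : Params) (hM : ∀ a ≠ 3, P.mass a ≠ 0) (κ : Couplings) (c : Renorm)
    {l : Fin 4 → ℝ} (b : Fin 4) (hb : b ≠ 3) (k : Fin 4 → ℝ)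
    (f f' : Lepton) {p : Fin 4 → ℝ} (hp : Regular P l p) :
    crossB P κ c l b (.higgs k) f f' p = (I / (2 * P.mW : ℂ)) • κ.scal b f f' := by
  have h' : (P.mass b : ℂ) ≠ 0 := by exact_mod_cast hM b hb
  rw [crossB, ← neg_sub, contract_A_sub_dphi P κ c (hM b hb) f f' hp.1 (hp.2.2.1 b), ← neg_smul,
    smul_smul, higgsCoeff]
  congr 1
  push_cast
  field_simp

theorem crossR_eq (P : Params) (κ : Couplings) (Q : FermiCurrent) (l : Fin 4 → ℝ) (b : Fin 4)
    (X : ExtBoson) (f f' : Lepton) {p : Fin 4 → ℝ} (hp : Regular P l p) :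
    crossR P κ Q l b X f f' p
      = -∑ h : Lepton, (Q.q b f h • 1 - Q.qt b f h • gam5) * vertex κ l X h f' := by
  rw [crossR, ← Finset.sum_neg_distrib]
  refine Finset.sum_congr rfl fun h _ => ?_
  rw [obsRight_eq _ _ (hp.2.2.2 h), mul_neg, mul_one, neg_mul]

theorem crossL_eq (P : Params) (κ : Couplings) (Q : FermiCurrent) (l : Fin 4 → ℝ) (b : Fin 4)
    (X : ExtBoson) (f f' : Lepton) {p : Fin 4 → ℝ} (hp : Regular P l p) :
    crossL P κ Q l b X f f' p
      = ∑ h : Lepton, vertex κ l X f h * (Q.q b h f' • 1 + Q.qt b h f' • gam5) := by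
  rw [crossL]
  refine Finset.sum_congr rfl fun h _ => ?_
  rw [obsLeft_eq _ _ (hp.2.2.2 h), mul_one]

/-! ## Kinematics -/

theorem mdot_add_left (p q r : Fin 4 → ℝ) : mdot (p + q) r = mdot p r + mdot q r := by
  simp [mdot, mul_add, add_mul, Finset.sum_add_distrib]

theorem mdot_sub_left (p q r : Fin 4 → ℝ) : mdot (p - q) r = mdot p r - mdot q r := by
  simp [mdot, mul_sub, sub_mul, Finset.sum_sub_distrib]

theorem mdot_smul_left (s : ℝ) (p r : Fin 4 → ℝ) : mdot (s • p) r = s * mdot p r := by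
  simp only [mdot, Finset.mul_sum, Pi.smul_apply, smul_eq_mul]
  exact Finset.sum_congr rfl fun _ _ => by ring

theorem mdot_comm (p q : Fin 4 → ℝ) : mdot p q = mdot q p := by
  simp only [mdot]
  exact Finset.sum_congr rfl fun _ _ => by ring

theorem slash_add (p q : Fin 4 → ℝ) : slash (p + q) = slash p + slash q := by
  simp [slash, mul_add, add_smul, Finset.sum_add_distrib]

/-- A string direction. -/
def lstr : Fin 4 → ℝ := ![1, 0, 0, 1]

/-- A spacelike tangent vector at `lstr`. -/
def tstr : Fin 4 → ℝ := ![0, 1, 0, 0]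

/-- The lightlike vector dual to `lstr`. -/
def nstr : Fin 4 → ℝ := ![1 / 2, 0, 0, -1 / 2]

/-- Spacelike vectors orthogonal to `lstr`. -/
def avec (β : ℝ) : Fin 4 → ℝ := ![β, 0, 1, β]

/-- A momentum of mass `m` in the plane of `lstr` and `nstr`. -/
def kbos (m : ℝ) : Fin 4 → ℝ := ![1 / 2 + m ^ 2 / 2, 0, 0, -1 / 2 + m ^ 2 / 2]

/-- Momenta with constant product with `lstr`, differing by multiples of `avec β`. -/
def kferm (β α σ s : ℝ) : Fin 4 → ℝ :=
  ![σ * (1 / 2 + α) + s * β, 0, σ * β + s, σ * (-1 / 2 + α) + s * β]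

theorem isString_lstr : IsString lstr := by
  simp [IsString, mdot, eta, Fin.sum_univ_four, lstr]

theorem mdot_lstr_tstr : mdot lstr tstr = 0 := by
  simp [mdot, eta, Fin.sum_univ_four, lstr, tstr]

theorem mdot_nstr_lstr : mdot nstr lstr = 1 := by
  simp [mdot, eta, Fin.sum_univ_four, lstr, nstr]
  norm_num

theorem mdot_avec_lstr (β : ℝ) : mdot (avec β) lstr = 0 := by
  simp [mdot, eta, Fin.sum_univ_four, lstr, avec]

theorem mdot_avec_avec (β : ℝ) : mdot (avec β) (avec β) = -1 := by
  simp [mdot, eta, Fin.sum_univ_four, avec]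

theorem mdot_kbos_lstr (m : ℝ) : mdot (kbos m) lstr = 1 := by
  simp [mdot, eta, Fin.sum_univ_four, lstr, kbos]
  norm_num

theorem mdot_kbos_kbos (m : ℝ) : mdot (kbos m) (kbos m) = m ^ 2 := by
  simp [mdot, eta, Fin.sum_univ_four, kbos]
  ring

theorem mdot_kferm_lstr (β α σ s : ℝ) : mdot (kferm β α σ s) lstr = σ := by
  simp [mdot, eta, Fin.sum_univ_four, lstr, kferm]
  ring

theorem mdot_kferm_kferm (β α s : ℝ) {σ : ℝ} (hσ : σ ^ 2 = 1) :
    mdot (kferm β α σ s) (kferm β α σ s) = 2 * α - β ^ 2 - s ^ 2 := by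
  simp [mdot, eta, Fin.sum_univ_four, kferm]
  linear_combination (2 * α - β ^ 2) * hσ

theorem mdot_kferm_sub (β α σ s s' : ℝ) :
    mdot (kferm β α σ s - kferm β α σ s') (kferm β α σ s - kferm β α σ s') = -(s - s') ^ 2 := by
  simp [mdot, eta, Fin.sum_univ_four, kferm]
  ring

/-- With opposite `σ` the components along `nstr` cancel. The `lstr` part can then be tuned against
the bosons, leaving only a shift along `avec β`. -/
theorem kferm_add_kferm (β α α' s s' : ℝ) :
    kferm β α 1 s + kferm β α' (-1) s' = (α - α') • lstr + (s + s') • avec β := by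
  ext i
  fin_cases i <;> simp [kferm, lstr, avec] <;> ring

theorem kferm_ne_zero (β α s : ℝ) {σ : ℝ} (hσ : σ ^ 2 = 1) : kferm β α σ s ≠ 0 := by
  intro h
  have h1 := mdot_kferm_lstr β α σ s
  rw [h] at h1
  simp [mdot] at h1
  simp [← h1] at hσ

theorem kbos_add_kbos (m m' : ℝ) :
    kbos m + kbos m' = (2 : ℝ) • nstr + ((m ^ 2 + m' ^ 2) / 2) • lstr := by
  ext i
  fin_cases i <;> simp [kbos, lstr, nstr] <;> ring

/-- A long shift along a spacelike vector makes the square of the momentum negative, hence different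
from every squared mass, and keeps the product with `l`. -/
theorem regular_add_smul (P : Params) {l v A : Fin 4 → ℝ} (hv : mdot v l ≠ 0) (hA : mdot A l = 0)
    (hA' : mdot A A = -1) {d : ℝ} (hd : 1 + |mdot v v| + 2 * |mdot v A| ≤ |d|) :
    Regular P l (v + d • A) := by
  have h1 : mdot (v + d • A) l ≠ 0 := by
    rwa [mdot_add_left, mdot_smul_left, hA, mul_zero, add_zero]
  have h2 : mdot (v + d • A) (v + d • A) < 0 := by
    have e : mdot (v + d • A) (v + d • A) = mdot v v + 2 * (d * mdot v A) - d ^ 2 := by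
      rw [mdot_add_left, mdot_smul_left, mdot_comm v, mdot_comm A, mdot_add_left, mdot_add_left,
        mdot_smul_left, mdot_smul_left, hA', mdot_comm A v]
      ring
    rw [e, ← sq_abs d]
    have h3 : d * mdot v A ≤ |d| * |mdot v A| := by rw [← abs_mul]; exact le_abs_self _
    have h4 := le_abs_self (mdot v v)
    have h5 := abs_nonneg (mdot v v)
    have h6 := abs_nonneg (mdot v A)
    have h7 : |d| * (1 + |mdot v v| + 2 * |mdot v A|) ≤ |d| * |d| :=
      mul_le_mul_of_nonneg_left hd (abs_nonneg d)
    have h8 : 1 ≤ |d| := by linarith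
    nlinarith [mul_le_mul_of_nonneg_right h8 h5]
  exact ⟨h1, (h2.trans_le (sq_nonneg _)).ne, fun _ => (h2.trans_le (sq_nonneg _)).ne,
    fun _ => (h2.trans_le (sq_nonneg _)).ne⟩

open Filter in
theorem eventually_regular (P : Params) {l v A : Fin 4 → ℝ} (hv : mdot v l ≠ 0)
    (hA : mdot A l = 0) (hA' : mdot A A = -1) :
    ∀ᶠ d : ℝ in atTop, Regular P l (v + d • A) ∧ Regular P l (v - d • A) := by
  filter_upwards [eventually_ge_atTop (1 + |mdot v v| + 2 * |mdot v A|)] with d hd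
  refine ⟨regular_add_smul P hv hA hA' (hd.trans (le_abs_self d)), ?_⟩
  rw [sub_eq_add_neg, ← neg_smul]
  exact regular_add_smul P hv hA hA' (by rw [abs_neg]; exact hd.trans (le_abs_self d))

/-! ## First order -/

theorem slash_mul_gam5 (p : Fin 4 → ℝ) : slash p * gam5 = -(gam5 * slash p) := by
  rw [slash_eq, gam5_eq]
  ext i j
  fin_cases i <;> fin_cases j <;> simp [Matrix.mul_apply, Fin.sum_univ_four, sub_eq_add_neg]

theorem sum_dotProduct_gam (K : Fin 4 → ℝ) (N : Matrix (Fin 4) (Fin 4) ℂ) (ub u : Fin 4 → ℂ) :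
    ∑ μ, (eta μ : ℂ) * (K μ : ℂ) * (ub ⬝ᵥ ((gam μ * N) *ᵥ u)) = ub ⬝ᵥ ((slash K * N) *ᵥ u) := by
  rw [slash, Finset.sum_mul, Matrix.sum_mulVec, dotProduct_sum]
  refine Finset.sum_congr rfl fun μ _ => ?_
  rw [Matrix.smul_mul, smul_mulVec, dotProduct_smul, smul_eq_mul]

theorem chir_eq (x y : ℂ) : x • (1 : Matrix (Fin 4) (Fin 4) ℂ) + y • gam5
    = diagonal ![x - y, x - y, x + y, x + y] := by
  rw [gam5_eq]
  ext i j
  fin_cases i <;> fin_cases j <;> simp [sub_eq_add_neg]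

/-- The polarization vector `tstr` for a boson with momentum `kbos m`. -/
def ybos (P : Params) (b : Fin 4) : BosonLeg := ⟨b, kbos (P.mass b), fun μ => (tstr μ : ℂ)⟩

theorem ybos_onShell (P : Params) (b : Fin 4) : (ybos P b).OnShell P lstr := by
  refine ⟨mdot_kbos_kbos _, ?_, ?_⟩
  · simp [ybos, mdot_kbos_lstr]
  · simp [ybos, cdot, tstr, kbos, Fin.sum_univ_four]

theorem ybos_w (P : Params) (b : Fin 4) : (ybos P b).w lstr tstr = I := by
  have h : mdot (kbos (P.mass b)) tstr = 0 := by
    simp [mdot, Fin.sum_univ_four, tstr, kbos]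
  have h' : cdot tstr (fun μ => (tstr μ : ℂ)) = -1 := by
    simp [cdot, Fin.sum_univ_four, tstr, eta]
  simp [BosonLeg.w, wField, ybos, mdot_kbos_lstr, h, h']

/-- Since `tstr` is orthogonal to the momentum, the denominator stays 1 along the line `lstr + s •
tstr`, and the potential is affine in `s`; its string derivative is the momentum. -/
theorem ybos_A (P : Params) (b : Fin 4) (s : ℝ) (μ : Fin 4) :
    (ybos P b).A (lstr + s • tstr) μ = (tstr μ : ℂ) + s * (kbos (P.mass b) μ : ℂ) := by
  have h : mdot (kbos (P.mass b)) (lstr + s • tstr) = 1 := by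
    simp [mdot, Fin.sum_univ_four, tstr, kbos, lstr, eta]
    norm_num
  have h' : cdot (lstr + s • tstr) (fun μ => (tstr μ : ℂ)) = -s := by
    simp [cdot, Fin.sum_univ_four, tstr, eta, lstr]
  simp [BosonLeg.A, annih, ybos, h, h']
  ring

theorem ybos_phi (P : Params) (κ : Couplings) (b : Fin 4) (f f' : Lepton) (s : ℝ) :
    (ybos P b).phi (lstr + s • tstr) • κ.scal b f f' = (s * I : ℂ) • κ.scal b f f' := by
  by_cases hb : b = 3
  · subst hb
    simp [scal_photon]
  have h : mdot (kbos (P.mass b)) (lstr + s • tstr) = 1 := by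
    simp [mdot, Fin.sum_univ_four, tstr, kbos, lstr, eta]
    norm_num
  have h' : cdot (lstr + s • tstr) (fun μ => (tstr μ : ℂ)) = -s := by
    simp [cdot, Fin.sum_univ_four, tstr, eta, lstr]
  congr 1
  simp [BosonLeg.phi, annih, ybos, h, h', hb]
  ring

/-- The coefficient of `A_{aμ} ψ̄_f γ^μ ψ_{f'}`. -/
def Couplings.bv (κ : Couplings) : Fin 4 → Lepton → Lepton → ℂ :=
  realBasis κ.b1 κ.b2 κ.b3 κ.b4 κ.b5 κ.b6

/-- The coefficient of `A_{aμ} ψ̄_f γ^μ γ⁵ ψ_{f'}`. -/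
def Couplings.bvt (κ : Couplings) : Fin 4 → Lepton → Lepton → ℂ :=
  realBasis κ.bt1 κ.bt2 κ.bt3 κ.bt4 κ.bt5 κ.bt6

/-- The coefficient of `φ_a ψ̄_f ψ_{f'}`. -/
def Couplings.cs (κ : Couplings) : Fin 4 → Lepton → Lepton → ℂ :=
  realBasis κ.c1 κ.c2 κ.c3 κ.c4 0 0

/-- The coefficient of `φ_a ψ̄_f γ⁵ ψ_{f'}`. -/
def Couplings.cst (κ : Couplings) : Fin 4 → Lepton → Lepton → ℂ :=
  realBasis κ.ct1 κ.ct2 κ.ct3 κ.ct4 0 0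

theorem sum_vec (κ : Couplings) (a : Fin 4) (f f' : Lepton) (A : Fin 4 → ℝ) :
    ∑ μ, ((eta μ : ℂ) * (A μ : ℂ)) • κ.vec a f f' μ
      = slash A * (κ.bv a f f' • 1 + κ.bvt a f f' • gam5) := by
  simp only [Couplings.vec, slash, Finset.sum_mul, Matrix.smul_mul]
  rfl

/-- The boson momentum stays fixed while each lepton momentum takes two values. The Dirac equations
replace the lepton momenta in the divergence by masses, so the same matrix is tested on all spinors.
-/
theorem FirstOrder.matrix {P : Params} (hg : P.g ≠ 0) {κ : Couplings} {Q : FermiCurrent}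
    (h : FirstOrder P κ Q) (a : Fin 4) (f f' : Lepton) :
    slash (kbos (P.mass a))
        * ((κ.bv a f f' - Q.q a f f') • 1 + (κ.bvt a f f' - Q.qt a f f') • gam5)
      + I • (κ.cs a f f' • 1 + κ.cst a f f' • gam5)
      + (((P.lmass f - P.lmass f') * Q.q a f f' : ℂ) • 1
        + ((P.lmass f + P.lmass f') * Q.qt a f f' : ℂ) • gam5) = 0 := by
  have hsh : ∀ (m : ℝ) (i : Bool), mdot (kferm 0 ((m ^ 2 + 1) / 2) 1 (if i then 1 else -1))
      (kferm 0 ((m ^ 2 + 1) / 2) 1 (if i then 1 else -1)) = m ^ 2 := by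
    intro m i
    rw [mdot_kferm_kferm _ _ _ (by norm_num)]
    cases i <;> simp <;> ring
  refine eq_zero_of_onShell (P := P) (f := f) (f' := f')
    (k₁ := fun i => kferm 0 ((P.lmass f ^ 2 + 1) / 2) 1 (if i then 1 else -1))
    (k₂ := fun i => kferm 0 ((P.lmass f' ^ 2 + 1) / 2) 1 (if i then 1 else -1)) (hsh _) (hsh _) ?_ ?_ ?_
  · rw [mdot_kferm_sub]; norm_num
  · rw [mdot_kferm_sub]; norm_num
  intro i j ub u hub hu
  have key := h lstr tstr (ybos P a) 
    ⟨f, kferm 0 ((P.lmass f ^ 2 + 1) / 2) 1 (if i then 1 else -1), ub⟩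
    ⟨f', kferm 0 ((P.lmass f' ^ 2 + 1) / 2) 1 (if j then 1 else -1), u⟩ isString_lstr mdot_lstr_tstr
    (ybos_onShell P a) ⟨hsh _ i, kferm_ne_zero _ _ _ (by norm_num), hub⟩
    ⟨hsh _ j, kferm_ne_zero _ _ _ (by norm_num), hu⟩
  set k₁ := kferm 0 ((P.lmass f ^ 2 + 1) / 2) 1 (if i then 1 else -1)
  set k₂ := kferm 0 ((P.lmass f' ^ 2 + 1) / 2) 1 (if j then 1 else -1)
  have hv : ∀ s : ℝ, S1F P κ (lstr + s • tstr) (.gauge (ybos P a)) ⟨f, k₁, ub⟩ ⟨f', k₂, u⟩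
      = P.g * (ub ⬝ᵥ ((slash tstr * (κ.bv a f f' • 1 + κ.bvt a f f' • gam5)) *ᵥ u))
        + (s : ℂ) * (P.g * (ub ⬝ᵥ ((slash (kbos (P.mass a))
            * (κ.bv a f f' • 1 + κ.bvt a f f' • gam5) + I • κ.scal a f f') *ᵥ u))) := by
    intro s
    have e : vertex κ (lstr + s • tstr) (.gauge (ybos P a)) f f'
        = slash tstr * (κ.bv a f f' • 1 + κ.bvt a f f' • gam5) + (s : ℂ) • (slash (kbos (P.mass a))
            * (κ.bv a f f' • 1 + κ.bvt a f f' • gam5) + I • κ.scal a f f') := by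
      have h1 : (∑ μ, ((eta μ : ℂ) * (ybos P a).A (lstr + s • tstr) μ) • κ.vec a f f' μ)
          = (∑ μ, ((eta μ : ℂ) * (tstr μ : ℂ)) • κ.vec a f f' μ)
            + (s : ℂ) • ∑ μ, ((eta μ : ℂ) * (kbos (P.mass a) μ : ℂ)) • κ.vec a f f' μ := by
        rw [Finset.smul_sum, ← Finset.sum_add_distrib]
        refine Finset.sum_congr rfl fun μ _ => ?_
        rw [ybos_A]
        module
      change (∑ μ, ((eta μ : ℂ) * (ybos P a).A (lstr + s • tstr) μ) • κ.vec a f f' μ)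
        + (ybos P a).phi (lstr + s • tstr) • κ.scal a f f' = _
      rw [h1, sum_vec, sum_vec, ybos_phi]
      module
    rw [S1F, e, add_mulVec, smul_mulVec, dotProduct_add, dotProduct_smul, smul_eq_mul]
    ring
  have hder : lineDeriv ℝ (fun l' => S1F P κ l' (.gauge (ybos P a)) ⟨f, k₁, ub⟩ ⟨f', k₂, u⟩)
      lstr tstr = P.g * (ub ⬝ᵥ ((slash (kbos (P.mass a))
            * (κ.bv a f f' • 1 + κ.bvt a f f' • gam5) + I • κ.scal a f f') *ᵥ u)) := by
    rw [lineDeriv]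
    simp only [hv]
    have := (((hasDerivAt_id (0 : ℝ)).ofReal_comp).mul_const (P.g * (ub ⬝ᵥ ((slash (kbos (P.mass a))
            * (κ.bv a f f' • 1 + κ.bvt a f f' • gam5) + I • κ.scal a f f') *ᵥ u)) : ℂ)).const_add
            (P.g * (ub ⬝ᵥ ((slash tstr * (κ.bv a f f' • 1 + κ.bvt a f f' • gam5)) *ᵥ u)) : ℂ)
    simpa using this.deriv
  set N := Q.q a f f' • (1 : Matrix (Fin 4) (Fin 4) ℂ) + Q.qt a f f' • gam5 with hN
  have hrhs : ∑ μ, (eta μ : ℂ) * (-I * (((ybos P a).k μ + k₁ μ + k₂ μ : ℝ) : ℂ))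
        * Q1F P Q lstr tstr (ybos P a) ⟨f, k₁, ub⟩ ⟨f', k₂, u⟩ μ
      = P.g * (ub ⬝ᵥ ((slash (kbos (P.mass a) + k₁ + k₂) * N) *ᵥ u)) := by
    rw [← sum_dotProduct_gam, Finset.mul_sum]
    refine Finset.sum_congr rfl fun μ _ => ?_
    rw [Q1F, ybos_w]
    change (eta μ : ℂ) * (-I * ((kbos (P.mass a) μ + k₁ μ + k₂ μ : ℝ) : ℂ)) *
      (P.g * I * (ub ⬝ᵥ ((gam μ * N) *ᵥ u))) = _
    simp only [Pi.add_apply]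
    linear_combination (-(eta μ : ℂ) * ((kbos (P.mass a) μ + k₁ μ + k₂ μ : ℝ) : ℂ) * P.g
      * (ub ⬝ᵥ ((gam μ * N) *ᵥ u))) * I_mul_I
  rw [hder, hrhs] at key
  have key' := mul_left_cancel₀ (by exact_mod_cast hg) key
  have h1 : ub ⬝ᵥ ((slash k₁ * N) *ᵥ u) = -(P.lmass f : ℂ) * (ub ⬝ᵥ (N *ᵥ u)) := by
    rw [← mulVec_mulVec, dotProduct_mulVec, hub, smul_dotProduct, smul_eq_mul]
  have h2 : slash k₂ * N = (Q.q a f f' • 1 - Q.qt a f f' • gam5) * slash k₂ := by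
    rw [hN, mul_add, Matrix.mul_smul, Matrix.mul_smul, slash_mul_gam5, sub_mul, Matrix.smul_mul,
      Matrix.smul_mul, mul_one, one_mul, smul_neg, sub_eq_add_neg]
  have h3 : ub ⬝ᵥ ((slash k₂ * N) *ᵥ u)
      = (P.lmass f' : ℂ) * (ub ⬝ᵥ ((Q.q a f f' • 1 - Q.qt a f f' • gam5) *ᵥ u)) := by
    rw [h2, ← mulVec_mulVec, hu, mulVec_smul, dotProduct_smul, smul_eq_mul]
  simp only [slash_add, add_mul, add_mulVec, dotProduct_add, h1, h3] at key'
  have e : slash (kbos (P.mass a))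
        * ((κ.bv a f f' - Q.q a f f') • 1 + (κ.bvt a f f' - Q.qt a f f') • gam5)
      + I • (κ.cs a f f' • 1 + κ.cst a f f' • gam5)
      + (((P.lmass f - P.lmass f') * Q.q a f f' : ℂ) • 1
        + ((P.lmass f + P.lmass f') * Q.qt a f f' : ℂ) • gam5)
      = (slash (kbos (P.mass a)) * (κ.bv a f f' • 1 + κ.bvt a f f' • gam5) + I • κ.scal a f f')
        - slash (kbos (P.mass a)) * N + (P.lmass f : ℂ) • N
        - (P.lmass f' : ℂ) • (Q.q a f f' • 1 - Q.qt a f f' • gam5) := by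
    have : κ.scal a f f' = κ.cs a f f' • 1 + κ.cst a f f' • gam5 := rfl
    rw [this, hN]
    simp only [mul_add, mul_sub, Matrix.mul_smul, sub_smul]
    module
  rw [e]
  simp only [sub_mulVec, add_mulVec, dotProduct_sub, dotProduct_add, smul_mulVec, dotProduct_smul,
    smul_eq_mul] at key' ⊢
  linear_combination key'

theorem FirstOrder.coeffs {P : Params} (hg : P.g ≠ 0) {κ : Couplings} {Q : FermiCurrent}
    (h : FirstOrder P κ Q) (a : Fin 4) (f f' : Lepton) :
    Q.q a f f' = κ.bv a f f' ∧ Q.qt a f f' = κ.bvt a f f' ∧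
      κ.cs a f f' = I * ((P.lmass f - P.lmass f') * κ.bv a f f') ∧
      κ.cst a f f' = I * ((P.lmass f + P.lmass f') * κ.bvt a f f') := by
  have hM := h.matrix hg a f f'
  rw [slash_eq, chir_eq, chir_eq, chir_eq] at hM
  -- The off-diagonal entries see only `slash`, whose entry is `(kl) = 1` at both places; the
  -- diagonal entries see only the scalar terms. Each pair contains one entry per chirality.
  have h02 := congrFun (congrFun hM 0) 2
  have h31 := congrFun (congrFun hM 3) 1
  have h00 := congrFun (congrFun hM 0) 0
  have h22 := congrFun (congrFun hM 2) 2
  simp only [Matrix.add_apply, Matrix.smul_apply, mul_diagonal, diagonal_apply] at h02 h31 h00 h22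
  simp [kbos] at h02 h31 h00 h22
  ring_nf at h02 h31 h00 h22
  norm_num at h02 h31
  have hq : Q.q a f f' = κ.bv a f f' := by linear_combination (-h02 - h31) / 2
  have hqt : Q.qt a f f' = κ.bvt a f f' := by linear_combination (-h02 + h31) / 2
  refine ⟨hq, hqt, ?_, ?_⟩
  · rw [← hq]
    linear_combination -I * (h00 + h22) / 2 + κ.cs a f f' * I_mul_I
  · rw [← hqt]
    linear_combination -I * (h22 - h00) / 2 + κ.cst a f f' * I_mul_I

/-! ## Second order -/

/-- The mass shells require `τ² - τ'² = m'² - m² + 2Λ`, solved by `τ² = 1 + m'² + 2Λ` and `τ'² = 1 +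
m²`. As both are nonzero, the signs `±τ`, `±τ'` give two distinct momenta of each lepton. -/
theorem exists_kferm (β m m' Λ : ℝ) (hΛ : 0 ≤ Λ) :
    ∃ (α α' : ℝ) (τ τ' : ℝ), τ ≠ 0 ∧ τ' ≠ 0 ∧ α - α' = Λ ∧
      2 * α - β ^ 2 - τ ^ 2 = m ^ 2 ∧ 2 * α' - β ^ 2 - τ' ^ 2 = m' ^ 2 := by
  have h1 : 0 < 1 + m' ^ 2 + 2 * Λ := by positivity
  have h2 : 0 < 1 + m ^ 2 := by positivity
  refine ⟨(m ^ 2 + (1 + m' ^ 2 + 2 * Λ) + β ^ 2) / 2, (m' ^ 2 + (1 + m ^ 2) + β ^ 2) / 2,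
    Real.sqrt (1 + m' ^ 2 + 2 * Λ), Real.sqrt (1 + m ^ 2), (Real.sqrt_pos.2 h1).ne',
    (Real.sqrt_pos.2 h2).ne', ?_, ?_, ?_⟩
  · ring
  · rw [Real.sq_sqrt h1.le]; ring
  · rw [Real.sq_sqrt h2.le]; ring

/-- The crossings of `Q_1^F` with `S_1^F` (factor `w_b` left out). -/
def crossF (κ : Couplings) (Q : FermiCurrent) (l : Fin 4 → ℝ) (b : Fin 4) (X : ExtBoson)
    (f f' : Lepton) : Matrix (Fin 4) (Fin 4) ℂ :=
  ∑ h : Lepton, (vertex κ l X f h * (Q.q b h f' • 1 + Q.qt b h f' • gam5)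
    - (Q.q b f h • 1 - Q.qt b f h • gam5) * vertex κ l X h f')

theorem crossings_eq (P : Params) (κ : Couplings) (Q : FermiCurrent) (c : Renorm)
    (l t : Fin 4 → ℝ) (y : BosonLeg) (X : ExtBoson) (ψb ψ : FermionLeg) (R : Fin 4 → ℝ)
    (h1 : Regular P l (R - y.k - ψb.k)) (h2 : Regular P l (R - y.k - ψ.k)) :
    crossings P κ Q c l t y X ψb ψ R = (P.g : ℂ) ^ 2 * y.w l t * (ψb.u ⬝ᵥ
      ((crossB P κ c l y.a X ψb.f ψ.f (R - y.k - X.mom) + crossF κ Q l y.a X ψb.f ψ.f) *ᵥ ψ.u)) := by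
  rw [crossings, crossR_eq P κ Q l y.a X ψb.f ψ.f h1, crossL_eq P κ Q l y.a X ψb.f ψ.f h2, crossF,
    Finset.sum_sub_distrib, add_assoc, neg_add_eq_sub]

/-- The momenta are arranged so that the boson propagators of the two orderings carry `10 • nstr`
and `-12 • nstr`, up to multiples of `avec β`. By `hB` the bosonic part does not notice these
multiples, so it is the same for all four pairs of lepton momenta and the spinors can be removed. -/
theorem SecondOrder.matrix {P : Params} (hg : P.g ≠ 0) {κ : Couplings} {Q : FermiCurrent}
    {c : Renorm} (h : SecondOrder P κ Q c) {X : ExtBoson} {m : ℝ} (hX : X.OnShell P lstr)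
    (hmom : X.mom = kbos m) (hw : ∀ x, X = .gauge x → x.w lstr tstr = 0) (b : Fin 4) (β : ℝ)
    (f f' : Lepton) {B : Matrix (Fin 4) (Fin 4) ℂ}
    (hB : ∀ d d' : ℝ, Regular P lstr ((10 : ℝ) • nstr + d • avec β) →
      Regular P lstr ((-12 : ℝ) • nstr + d' • avec β) →
      crossB P κ c lstr b X f f' ((10 : ℝ) • nstr + d • avec β)
        + crossB P κ c lstr b X f f' ((-12 : ℝ) • nstr + d' • avec β) = B) :
    B + (2 : ℂ) • crossF κ Q lstr b X f f' = 0 := by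
  obtain ⟨α, α', τ, τ', hτ, hτ', hΛ, hα, hα'⟩ := exists_kferm β (P.lmass f) (P.lmass f')
    (((P.mass b) ^ 2 + m ^ 2) / 2) (by positivity)
  have hsh : ∀ i : Bool, mdot (kferm β α 1 (if i then τ else -τ))
      (kferm β α 1 (if i then τ else -τ)) = P.lmass f ^ 2 := by
    intro i
    rw [mdot_kferm_kferm _ _ _ (by norm_num), ← hα]
    cases i <;> simp
  have hsh' : ∀ i : Bool, mdot (kferm β α' (-1) (if i then τ' else -τ'))
      (kferm β α' (-1) (if i then τ' else -τ')) = P.lmass f' ^ 2 := by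
    intro i
    rw [mdot_kferm_kferm _ _ _ (by norm_num), ← hα']
    cases i <;> simp
  refine eq_zero_of_onShell (P := P) (f := f) (f' := f') hsh hsh' ?_ ?_ ?_
  · rw [mdot_kferm_sub]
    simp only [if_true, Bool.false_eq_true, if_false]
    have : τ - -τ ≠ 0 := by intro h0; apply hτ; linarith
    simpa using this
  · rw [mdot_kferm_sub]
    simp only [if_true, Bool.false_eq_true, if_false]
    have : τ' - -τ' ≠ 0 := by intro h0; apply hτ'; linarith
    simpa using this
  intro i j ub u hub hu
  generalize hs : (if i then τ else -τ) = s at hub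
  generalize hs' : (if j then τ' else -τ') = s' at hu
  have hsh := hsh i
  have hsh' := hsh' j
  rw [hs] at hsh
  rw [hs'] at hsh'
  have hk := kferm_add_kferm β α α' s s'
  rw [hΛ] at hk
  have hk1l := mdot_kferm_lstr β α 1 s
  have hk2l := mdot_kferm_lstr β α' (-1) s'
  have hk1 := kferm_ne_zero β α s (σ := 1) (by norm_num)
  have hk2 := kferm_ne_zero β α' s' (σ := -1) (by norm_num)
  generalize kferm β α 1 s = k₁ at *
  generalize kferm β α' (-1) s' = k₂ at *
  have hreg : ∀ {v : Fin 4 → ℝ}, mdot v lstr ≠ 0 → ∀ᶠ d : ℝ in Filter.atTop,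
      Regular P lstr (v + d • avec β) ∧ Regular P lstr (v - d • avec β) := fun hv =>
    eventually_regular P hv (mdot_avec_lstr β) (mdot_avec_avec β)
  have hn : ∀ z : ℝ, mdot (z • nstr) lstr = z := fun z => by
    rw [mdot_smul_left, mdot_nstr_lstr, mul_one]
  have hyk : (ybos P b).k = kbos (P.mass b) := rfl
  -- One large `d` makes all ten propagator momenta regular: five for `R`, five for the total
  -- momentum minus `R`. The multiple 10 of `nstr` keeps all their products with `lstr` nonzero.
  obtain ⟨d, ⟨r1, -⟩, ⟨r2, -⟩, ⟨r3, -⟩, ⟨r4, -⟩, ⟨r5, -⟩, ⟨-, q1⟩, ⟨-, q2⟩, ⟨-, q3⟩, ⟨-, q4⟩, ⟨-, q5⟩⟩ :=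
    ((hreg (v := (10 : ℝ) • nstr) (by rw [hn]; norm_num)).and <|
    (hreg (v := X.mom + (10 : ℝ) • nstr - k₁)
      (by rw [mdot_sub_left, mdot_add_left, hn, hmom, mdot_kbos_lstr, hk1l]; norm_num)).and <|
    (hreg (v := X.mom + (10 : ℝ) • nstr - k₂)
      (by rw [mdot_sub_left, mdot_add_left, hn, hmom, mdot_kbos_lstr, hk2l]; norm_num)).and <|
    (hreg (v := kbos (P.mass b) + (10 : ℝ) • nstr - k₁)
      (by rw [mdot_sub_left, mdot_add_left, hn, mdot_kbos_lstr, hk1l]; norm_num)).and <|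
    (hreg (v := kbos (P.mass b) + (10 : ℝ) • nstr - k₂)
      (by rw [mdot_sub_left, mdot_add_left, hn, mdot_kbos_lstr, hk2l]; norm_num)).and <|
    (hreg (v := (-12 : ℝ) • nstr + (s + s') • avec β)
      (by rw [mdot_add_left, hn, mdot_smul_left, mdot_avec_lstr]; norm_num)).and <|
    (hreg (v := k₂ - (10 : ℝ) • nstr - kbos (P.mass b))
      (by rw [mdot_sub_left, mdot_sub_left, hn, mdot_kbos_lstr, hk2l]; norm_num)).and <|
    (hreg (v := k₁ - (10 : ℝ) • nstr - kbos (P.mass b))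
      (by rw [mdot_sub_left, mdot_sub_left, hn, mdot_kbos_lstr, hk1l]; norm_num)).and <|
    (hreg (v := k₂ - (10 : ℝ) • nstr - X.mom)
      (by rw [mdot_sub_left, mdot_sub_left, hn, hmom, mdot_kbos_lstr, hk2l]; norm_num)).and <|
    (hreg (v := k₁ - (10 : ℝ) • nstr - X.mom)
      (by rw [mdot_sub_left, mdot_sub_left, hn, hmom, mdot_kbos_lstr, hk1l]; norm_num))).exists
  -- As `w` vanishes on `X`, the exchanged assignment of the bosons does not contribute.
  have hsym : ∀ R, crossingsSym P κ Q c lstr tstr (ybos P b) X ⟨f, k₁, ub⟩ ⟨f', k₂, u⟩ R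
      = crossings P κ Q c lstr tstr (ybos P b) X ⟨f, k₁, ub⟩ ⟨f', k₂, u⟩ R := by
    intro R
    cases X with
    | gauge x => simp [crossingsSym, crossings, hw x rfl]
    | higgs k => simp [crossingsSym]
  set R : Fin 4 → ℝ := kbos (P.mass b) + X.mom + (10 : ℝ) • nstr + d • avec β with hR
  have hbb := kbos_add_kbos (P.mass b) m
  rw [← hmom] at hbb
  have e1 : R - (ybos P b).k - X.mom = (10 : ℝ) • nstr + d • avec β := by
    rw [hR, hyk]; abel
  have e2 : R - (ybos P b).k - k₁ = X.mom + (10 : ℝ) • nstr - k₁ + d • avec β := by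
    rw [hR, hyk]; abel
  have e3 : R - (ybos P b).k - k₂ = X.mom + (10 : ℝ) • nstr - k₂ + d • avec β := by
    rw [hR, hyk]; abel
  have e4 : R - X.mom - k₁ = kbos (P.mass b) + (10 : ℝ) • nstr - k₁ + d • avec β := by
    rw [hR]; abel
  have e5 : R - X.mom - k₂ = kbos (P.mass b) + (10 : ℝ) • nstr - k₂ + d • avec β := by
    rw [hR]; abel
  have hT : totalMom (ybos P b) X ⟨f, k₁, ub⟩ ⟨f', k₂, u⟩ - R
      = k₁ + k₂ - (10 : ℝ) • nstr - d • avec β := by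
    rw [hR, totalMom, hyk]
    abel
  set R' : Fin 4 → ℝ := totalMom (ybos P b) X ⟨f, k₁, ub⟩ ⟨f', k₂, u⟩ - R with hR'
  -- The bosons contribute `-2 • nstr`, whence -12; their `lstr` part is cancelled by the choice of
  -- `Λ`.
  have e6 : R' - (ybos P b).k - X.mom
      = (-12 : ℝ) • nstr + (s + s') • avec β - d • avec β := by
    rw [hT, hyk, hk, sub_sub _ (kbos _), hbb]
    module
  have e7 : R' - (ybos P b).k - k₁ = k₂ - (10 : ℝ) • nstr - kbos (P.mass b) - d • avec β := by
    rw [hT, hyk]; abel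
  have e8 : R' - (ybos P b).k - k₂ = k₁ - (10 : ℝ) • nstr - kbos (P.mass b) - d • avec β := by
    rw [hT, hyk]; abel
  have e9 : R' - X.mom - k₁ = k₂ - (10 : ℝ) • nstr - X.mom - d • avec β := by
    rw [hT]; abel
  have e10 : R' - X.mom - k₂ = k₁ - (10 : ℝ) • nstr - X.mom - d • avec β := by
    rw [hT]; abel
  rw [← e1] at r1
  rw [← e2] at r2
  rw [← e3] at r3
  rw [← e4] at r4
  rw [← e5] at r5
  rw [← e6] at q1
  rw [← e7] at q2
  rw [← e8] at q3
  rw [← e9] at q4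
  rw [← e10] at q5
  have key := h lstr tstr (ybos P b) X ⟨f, k₁, ub⟩ ⟨f', k₂, u⟩ R isString_lstr mdot_lstr_tstr
    (ybos_onShell P b) hX ⟨hsh, hk1, hub⟩ ⟨hsh', hk2, hu⟩ ⟨r1, r2, r3, r4, r5⟩ ⟨q1, q2, q3, q4, q5⟩
  rw [← hR', hsym, hsym, crossings_eq _ _ _ _ _ _ _ _ _ _ _ r2 r3,
    crossings_eq _ _ _ _ _ _ _ _ _ _ _ q2 q3, ← mul_add, ← dotProduct_add, ← add_mulVec,
    ybos_w] at key
  have hne : (P.g : ℂ) ^ 2 * I ≠ 0 := mul_ne_zero (pow_ne_zero 2 (by exact_mod_cast hg)) I_ne_zero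
  have key' := (mul_eq_zero.1 key).resolve_left hne
  have e6' : R' - (ybos P b).k - X.mom
      = (-12 : ℝ) • nstr + (s + s' - d) • avec β := by rw [e6]; module
  rw [e1] at r1
  rw [e6'] at q1
  rw [← hB d (s + s' - d) r1 q1, ← e1, ← e6', two_smul, add_add_add_comm]
  exact key'

/-! ## The equations for the matrices of coefficients -/

/-- The renormalization of `F` is skew in the two indices contracted with `p` and `A`, so the shift
of `p` by `d • A` drops out; its argument `(pl)` is unchanged because `A` is orthogonal to `l`. -/
theorem renormDiv_add_smul (c : Renorm) (a : Fin 4) {l A : Fin 4 → ℝ} (hA : mdot A l = 0)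
    (p : Fin 4 → ℝ) (d : ℝ) (κ : Fin 4) :
    ∑ lam, (eta lam : ℂ) * (A lam : ℂ) * renormDiv c a (p + d • A) l lam κ
      = ∑ lam, (eta lam : ℂ) * (A lam : ℂ) * renormDiv c a p l lam κ := by
  have hl : mdot (p + d • A) l = mdot p l := by
    rw [mdot_add_left, mdot_smul_left, hA, mul_zero, add_zero]
  simp only [renormDiv, hl]
  generalize c a l (mdot p l) = C
  simp only [Fin.sum_univ_four, Pi.add_apply, Pi.smul_apply, smul_eq_mul]
  push_cast
  ring

theorem faradayCoeff_add_smul (c : Renorm) (a : Fin 4) {l A : Fin 4 → ℝ} (hA : mdot A l = 0)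
    (p : Fin 4 → ℝ) (d : ℝ) (κ : Fin 4) :
    faradayCoeff c a (p + d • A) l (fun μ => (A μ : ℂ)) κ
      = faradayCoeff c a p l (fun μ => (A μ : ℂ)) κ := by
  rw [faradayCoeff, faradayCoeff, renormDiv_add_smul c a hA]

/-- A boson with `w = 0`, `φ = -i` and `A = avec (-m ^ 2)`. -/
def xbos (P : Params) (a : Fin 4) : BosonLeg :=
  ⟨a, kbos (P.mass a), fun μ => (avec (-P.mass a ^ 2) μ : ℂ) + (kbos (P.mass a) μ : ℂ)⟩

theorem cdot_lstr_xbos (P : Params) (a : Fin 4) : cdot lstr (xbos P a).e = 1 := by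
  simp [cdot, xbos, Fin.sum_univ_four, lstr, eta, avec, kbos]
  ring

/-- The product of `kbos m` with `avec β` is `β`, so transversality of `avec β + kbos m` requires `β
= -m²`. -/
theorem xbos_onShell (P : Params) (a : Fin 4) : (xbos P a).OnShell P lstr := by
  refine ⟨mdot_kbos_kbos _, ?_, ?_⟩
  · simp [xbos, mdot_kbos_lstr]
  · simp [xbos, cdot, avec, kbos, Fin.sum_univ_four, eta]
    ring

theorem xbos_w (P : Params) (a : Fin 4) : (xbos P a).w lstr tstr = 0 := by
  simp [BosonLeg.w, wField, xbos, cdot, mdot, avec, kbos, Fin.sum_univ_four, tstr]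

theorem xbos_A (P : Params) (a : Fin 4) :
    (xbos P a).A lstr = fun μ => (avec (-P.mass a ^ 2) μ : ℂ) := by
  ext μ
  have h : mdot (xbos P a).k lstr = 1 := mdot_kbos_lstr _
  simp [BosonLeg.A, annih, cdot_lstr_xbos, h]
  simp [xbos]

theorem xbos_phi (P : Params) {a : Fin 4} (ha : a ≠ 3) : (xbos P a).phi lstr = -I := by
  have h : mdot (xbos P a).k lstr = 1 := mdot_kbos_lstr _
  simp [BosonLeg.phi, annih, cdot_lstr_xbos, h, show (xbos P a).a ≠ 3 from ha]

/-- All dependence on the time ordering is collected in `n`. It does not depend on the leptons,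
since the external potential is exactly the vector along which the propagator momenta are shifted.
-/
theorem SecondOrder.gauge {P : Params} (hg : P.g ≠ 0) (hM : ∀ a ≠ 3, P.mass a ≠ 0) {κ : Couplings}
    {Q : FermiCurrent} {c : Renorm} (h : SecondOrder P κ Q c) (b : Fin 4) {a : Fin 4} (ha : a ≠ 3) :
    ∃ n : Fin 4 → Fin 4 → ℂ, ∀ f f' : Lepton,
      ((∑ e, (2 * P.f e b a : ℂ) • ∑ ρ, n e ρ • κ.vec e f f' ρ)
        + (-2 * I : ℂ) • ((∑ e, ((escortCoeff P e b a : ℂ) * (-I / (P.mass e : ℂ) ^ 2))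
            • κ.scal e f f')
          - (if b = a then (higgsCoeff P b : ℂ) * I else 0) • κ.higgs f f'))
      + (2 : ℂ) • crossF κ Q lstr b (.gauge (xbos P a)) f f' = 0 := by
  set A : Fin 4 → ℂ := fun μ => (avec (-P.mass a ^ 2) μ : ℂ)
  refine ⟨fun e ρ => faradayCoeff c e ((10 : ℝ) • nstr) lstr A ρ
    + faradayCoeff c e ((-12 : ℝ) • nstr) lstr A ρ, fun f f' => ?_⟩
  refine h.matrix hg (X := .gauge (xbos P a)) (m := P.mass a) (xbos_onShell P a) rfl ?_ b
    (-P.mass a ^ 2) f f' ?_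
  · rintro x hx
    cases hx
    exact xbos_w P a
  · intro d d' hd hd'
    have hk : mdot (xbos P a).k lstr ≠ 0 := (xbos_onShell P a).2.1
    rw [crossB_gauge P hM κ c b _ hk f f' hd, crossB_gauge P hM κ c b _ hk f f' hd', xbos_A,
      xbos_phi P ha]
    simp only [faradayCoeff_add_smul c _ (mdot_avec_lstr _), add_smul, smul_add,
      Finset.sum_add_distrib]
    change _ + (-I) • ((∑ e, ((escortCoeff P e b a : ℂ) * (-I / (P.mass e : ℂ) ^ 2))
            • κ.scal e f f') - (if b = a then (higgsCoeff P b : ℂ) * I else 0) • κ.higgs f f')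
        + (_ + (-I) • ((∑ e, ((escortCoeff P e b a : ℂ) * (-I / (P.mass e : ℂ) ^ 2))
            • κ.scal e f f') - (if b = a then (higgsCoeff P b : ℂ) * I else 0) • κ.higgs f f')) = _
    rw [add_add_add_comm, ← two_smul ℂ ((-I) • _), smul_smul]
    congr 2
    ring

/-- With an external higgs particle `F` is not contracted, so no unknowns appear and any `β` would
do. -/
theorem SecondOrder.higgs {P : Params} (hg : P.g ≠ 0) (hM : ∀ a ≠ 3, P.mass a ≠ 0) {κ : Couplings}
    {Q : FermiCurrent} {c : Renorm} (h : SecondOrder P κ Q c) {b : Fin 4} (hb : b ≠ 3)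
    (f f' : Lepton) :
    (I / (2 * P.mW : ℂ)) • κ.scal b f f' + ∑ h : Lepton,
      (κ.higgs f h * (Q.q b h f' • 1 + Q.qt b h f' • gam5)
        - (Q.q b f h • 1 - Q.qt b f h • gam5) * κ.higgs h f') = 0 := by
  have key := h.matrix hg (X := .higgs (kbos P.mH)) (m := P.mH) (mdot_kbos_kbos _) rfl
    (fun x hx => by cases hx) b 0 f f' (fun d d' hd hd' => by
      rw [crossB_higgs P hM κ c b hb _ f f' hd, crossB_higgs P hM κ c b hb _ f f' hd', ← two_smul ℂ])
  rw [← smul_add] at key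
  exact (smul_eq_zero.1 key).resolve_left two_ne_zero

/-! ## Chirality components -/

theorem sum_lepton {M : Type*} [AddCommMonoid M] (g : Lepton → M) :
    ∑ h, g h = g .e + g .ν := by
  change ∑ h ∈ {Lepton.e, Lepton.ν}, g h = _
  rw [Finset.sum_pair (by decide)]

/-- The coefficient of `φ_4 ψ̄_f ψ_{f'}`. -/
def Couplings.hs (κ : Couplings) : Lepton → Lepton → ℂ
  | .e, .e => κ.c0
  | .ν, .ν => κ.c5
  | _, _ => 0

/-- The coefficient of `φ_4 ψ̄_f γ⁵ ψ_{f'}`. -/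
def Couplings.hst (κ : Couplings) : Lepton → Lepton → ℂ
  | .e, .e => κ.ct0
  | .ν, .ν => κ.ct5
  | _, _ => 0

theorem Couplings.higgs_eq (κ : Couplings) (f f' : Lepton) :
    κ.higgs f f' = κ.hs f f' • 1 + κ.hst f f' • gam5 := by
  cases f <;> cases f' <;> simp [Couplings.higgs, Couplings.hs, Couplings.hst]

/-- The components of given chirality `s = ±1` of the vector couplings. -/
def Couplings.B (κ : Couplings) (s : ℂ) (a : Fin 4) (f f' : Lepton) : ℂ :=
  κ.bv a f f' + s * κ.bvt a f f'

/-- The components of given chirality `s = ±1` of the escort couplings. -/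
def Couplings.S (κ : Couplings) (s : ℂ) (a : Fin 4) (f f' : Lepton) : ℂ :=
  κ.cs a f f' + s * κ.cst a f f'

/-- The components of given chirality `s = ±1` of the higgs couplings. -/
def Couplings.H (κ : Couplings) (s : ℂ) (f f' : Lepton) : ℂ :=
  κ.hs f f' + s * κ.hst f f'

theorem vertex_xbos (P : Params) (κ : Couplings) {a : Fin 4} (ha : a ≠ 3) (f f' : Lepton) :
    vertex κ lstr (.gauge (xbos P a)) f f'
      = slash (avec (-P.mass a ^ 2)) * (κ.bv a f f' • 1 + κ.bvt a f f' • gam5)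
        + (-I) • (κ.cs a f f' • 1 + κ.cst a f f' • gam5) := by
  change (∑ μ, ((eta μ : ℂ) * (xbos P a).A lstr μ) • κ.vec a f f' μ)
    + (xbos P a).phi lstr • κ.scal a f f' = _
  rw [xbos_A, xbos_phi P ha, sum_vec]
  rfl

theorem chir_eq' (x y : ℂ) : x • (1 : Matrix (Fin 4) (Fin 4) ℂ) - y • gam5
    = diagonal ![x + y, x + y, x - y, x - y] := by
  rw [sub_eq_add_neg, ← neg_smul, chir_eq]
  simp [sub_eq_add_neg]

theorem Couplings.scal_eq (κ : Couplings) (a : Fin 4) (f f' : Lepton) :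
    κ.scal a f f' = κ.cs a f f' • 1 + κ.cst a f f' • gam5 := rfl

theorem Couplings.vec_eq (κ : Couplings) (a : Fin 4) (f f' : Lepton) (μ : Fin 4) :
    κ.vec a f f' μ = gam μ * (κ.bv a f f' • 1 + κ.bvt a f f' • gam5) := rfl

theorem gam_diag (ρ i : Fin 4) : gam ρ i i = 0 := by
  fin_cases ρ <;> fin_cases i <;> simp [gam]

theorem slash_diag (p : Fin 4 → ℝ) (i : Fin 4) : slash p i i = 0 := by
  simp [slash, Matrix.sum_apply, gam_diag]

theorem vec_diag (κ : Couplings) (a : Fin 4) (f f' : Lepton) (ρ i : Fin 4) :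
    κ.vec a f f' ρ i i = 0 := by
  rw [Couplings.vec, chir_eq, mul_diagonal, gam_diag, zero_mul]

/-- The equations at second order for the couplings of the escort fields. -/
theorem SecondOrder.scalar {P : Params} (hg : P.g ≠ 0) (hM : ∀ a ≠ 3, P.mass a ≠ 0) {κ : Couplings}
    {Q : FermiCurrent} {c : Renorm} (h : SecondOrder P κ Q c)
    (hq : ∀ a f f', Q.q a f f' = κ.bv a f f') (hqt : ∀ a f f', Q.qt a f f' = κ.bvt a f f')
    {s : ℂ} (hs : s = 1 ∨ s = -1) (b : Fin 4) {a : Fin 4} (ha : a ≠ 3) (f f' : Lepton) :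
    ∑ h, (κ.S s a f h * κ.B s b h f' - κ.B (-s) b f h * κ.S s a h f')
      = I * (∑ e, (escortCoeff P e b a : ℂ) / (P.mass e : ℂ) ^ 2 * κ.S s e f f'
          + if b = a then (higgsCoeff P b : ℂ) * κ.H s f f' else 0) := by
  obtain ⟨n, hn⟩ := h.gauge hg hM b ha
  have hn := hn f f'
  simp only [crossF, vertex_xbos P κ ha, hq, hqt, κ.higgs_eq, κ.scal_eq, chir_eq', chir_eq] at hn
  -- A diagonal entry selects one chirality and kills everything with a single Dirac matrix, in
  -- particular the unknowns `n`.
  have key : ∀ i : Fin 4, diagonal (n := Fin 4) (α := ℂ) ![-1, -1, 1, 1] i i = s →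
      ∑ h, (κ.S s a f h * κ.B s b h f' - κ.B (-s) b f h * κ.S s a h f')
      = I * (∑ e, (escortCoeff P e b a : ℂ) / (P.mass e : ℂ) ^ 2 * κ.S s e f f'
          + if b = a then (higgsCoeff P b : ℂ) * κ.H s f f' else 0) := by
    intro i hi
    have h1 := congrFun (congrFun hn i) i
    have d1 : ∀ x y : ℂ, (![x - y, x - y, x + y, x + y] : Fin 4 → ℂ) i = x + s * y := by
      intro x y
      rw [← hi]
      fin_cases i <;> simp [sub_eq_add_neg]
    have d2 : ∀ x y : ℂ, (![x + y, x + y, x - y, x - y] : Fin 4 → ℂ) i = x + (-s) * y := by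
      intro x y
      rw [← hi]
      fin_cases i <;> simp [sub_eq_add_neg]
    simp only [Matrix.add_apply, Matrix.smul_apply, Matrix.sub_apply, Matrix.sum_apply,
      mul_diagonal, diagonal_mul, diagonal_apply_eq, d1, d2, vec_diag, slash_diag, smul_eq_mul,
      mul_zero, Finset.sum_const_zero, zero_mul, zero_add, Matrix.zero_apply] at h1
    have h2 : ∑ h, (κ.S s a f h * κ.B s b h f' - κ.B (-s) b f h * κ.S s a h f')
        = I * ∑ h, (-I * (κ.cs a f h + s * κ.cst a f h) * (κ.bv b h f' + s * κ.bvt b h f')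
          - (κ.bv b f h + -s * κ.bvt b f h) * (-I * (κ.cs a h f' + s * κ.cst a h f'))) := by
      rw [Finset.mul_sum]
      refine Finset.sum_congr rfl fun h _ => ?_
      simp only [Couplings.S, Couplings.B]
      linear_combination ((κ.cs a f h + s * κ.cst a f h) * (κ.bv b h f' + s * κ.bvt b h f')
        - (κ.bv b f h + -s * κ.bvt b f h) * (κ.cs a h f' + s * κ.cst a h f')) * I_mul_I
    have h3 : (∑ e, (escortCoeff P e b a : ℂ) / (P.mass e : ℂ) ^ 2 * κ.S s e f f')
        = I * ∑ e, (escortCoeff P e b a : ℂ) * (-I / (P.mass e : ℂ) ^ 2)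
          * (κ.cs e f f' + s * κ.cst e f f') := by
      rw [Finset.mul_sum]
      refine Finset.sum_congr rfl fun e _ => ?_
      simp only [Couplings.S]
      linear_combination ((escortCoeff P e b a : ℂ) * (1 / (P.mass e : ℂ) ^ 2)
          * (κ.cs e f f' + s * κ.cst e f f')) * I_mul_I
    rw [h2, h3]
    simp only [Couplings.H]
    split_ifs at h1 ⊢
    · linear_combination I / 2 * h1 - I * (higgsCoeff P b : ℂ) * (κ.hs f f' + s * κ.hst f f') * I_mul_I
    · linear_combination I / 2 * h1
  rcases hs with rfl | rfl
  · exact key 2 (by simp)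
  · exact key 0 (by simp)

/-- The equations at second order for the couplings of the vector bosons, with unknown
coefficients `r` that depend on the time ordering. -/
theorem SecondOrder.vector {P : Params} (hg : P.g ≠ 0) (hM : ∀ a ≠ 3, P.mass a ≠ 0) {κ : Couplings}
    {Q : FermiCurrent} {c : Renorm} (h : SecondOrder P κ Q c)
    (hq : ∀ a f f', Q.q a f f' = κ.bv a f f') (hqt : ∀ a f f', Q.qt a f f' = κ.bvt a f f')
    (b : Fin 4) {a : Fin 4} (ha : a ≠ 3) :
    ∃ r : Fin 4 → ℂ, ∀ s : ℂ, s = 1 ∨ s = -1 → ∀ f f',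
      ∑ h, (κ.B s a f h * κ.B s b h f' - κ.B s b f h * κ.B s a h f')
        = ∑ e, (P.f e b a : ℂ) * r e * κ.B s e f f' := by
  obtain ⟨n, hn⟩ := h.gauge hg hM b ha
  refine ⟨fun e => n e 2, fun s hs f f' => ?_⟩
  have hn := hn f f'
  simp only [crossF, vertex_xbos P κ ha, hq, hqt, κ.higgs_eq, κ.scal_eq, κ.vec_eq,
    chir_eq', chir_eq] at hn
  -- A difference of two off-diagonal entries within one chirality isolates the coefficient of `gam
  -- 2`, the direction in which `avec` has component 1. The coefficient `n e 2` is thus the same for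
  -- both chiralities.
  have key : ∀ i j k m : Fin 4, ∀ z : ℂ, z ≠ 0 → i ≠ j → k ≠ m →
      (∀ x y : ℂ, (![x - y, x - y, x + y, x + y] : Fin 4 → ℂ) j = x + s * y) →
      (∀ x y : ℂ, (![x - y, x - y, x + y, x + y] : Fin 4 → ℂ) m = x + s * y) →
      (∀ x y : ℂ, (![x + y, x + y, x - y, x - y] : Fin 4 → ℂ) i = x + s * y) →
      (∀ x y : ℂ, (![x + y, x + y, x - y, x - y] : Fin 4 → ℂ) k = x + s * y) →
      (∀ ρ, gam ρ i j - gam ρ k m = if ρ = 2 then z else 0) →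
      (slash (avec (-P.mass a ^ 2)) i j - slash (avec (-P.mass a ^ 2)) k m = -z) →
      ∑ h, (κ.B s a f h * κ.B s b h f' - κ.B s b f h * κ.B s a h f')
        = ∑ e, (P.f e b a : ℂ) * n e 2 * κ.B s e f f' := by
    intro i j k m z hz hij hkm d1 d2 d3 d4 hgam hsl
    have h1 := congrFun (congrFun hn i) j
    have h2 := congrFun (congrFun hn k) m
    simp only [Matrix.add_apply, Matrix.smul_apply, Matrix.sub_apply, Matrix.sum_apply,
      mul_diagonal, diagonal_mul, diagonal_apply_ne _ hij, diagonal_apply_ne _ hkm, d1, d2, d3, d4,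
      smul_eq_mul, mul_zero, Finset.sum_const_zero, sub_zero, add_zero, Matrix.zero_apply] at h1 h2
    refine mul_left_cancel₀ (mul_ne_zero two_ne_zero hz) ?_
    have e1 : ∀ e, (∑ ρ, n e ρ * (gam ρ i j * (κ.bv e f f' + s * κ.bvt e f f')))
        - (∑ ρ, n e ρ * (gam ρ k m * (κ.bv e f f' + s * κ.bvt e f f')))
        = z * (n e 2 * κ.B s e f f') := by
      intro e
      rw [← Finset.sum_sub_distrib]
      calc _ = ∑ ρ, (gam ρ i j - gam ρ k m) * (n e ρ * (κ.bv e f f' + s * κ.bvt e f f')) :=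
            Finset.sum_congr rfl fun ρ _ => by ring
        _ = _ := by simp [hgam, Couplings.B]
    have e2 : (∑ e, 2 * (P.f e b a : ℂ)
          * ∑ ρ, n e ρ * (gam ρ i j * (κ.bv e f f' + s * κ.bvt e f f')))
        - (∑ e, 2 * (P.f e b a : ℂ) * ∑ ρ, n e ρ * (gam ρ k m * (κ.bv e f f' + s * κ.bvt e f f')))
        = 2 * z * ∑ e, (P.f e b a : ℂ) * n e 2 * κ.B s e f f' := by
      rw [← Finset.sum_sub_distrib, Finset.mul_sum]
      refine Finset.sum_congr rfl fun e _ => ?_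
      rw [← mul_sub, e1]
      ring
    rw [← e2, eq_sub_of_add_eq h1, eq_sub_of_add_eq h2, sum_lepton, sum_lepton, sum_lepton]
    simp only [Couplings.B]
    linear_combination (2 * ((κ.bv a f .e + s * κ.bvt a f .e) * (κ.bv b .e f' + s * κ.bvt b .e f')
      - (κ.bv b f .e + s * κ.bvt b f .e) * (κ.bv a .e f' + s * κ.bvt a .e f')
      + (κ.bv a f .ν + s * κ.bvt a f .ν) * (κ.bv b .ν f' + s * κ.bvt b .ν f')
      - (κ.bv b f .ν + s * κ.bvt b f .ν) * (κ.bv a .ν f' + s * κ.bvt a .ν f'))) * hsl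
  rcases hs with rfl | rfl
  · refine key 1 2 0 3 (2 * I) (by simp) (by decide) (by decide) ?_ ?_ ?_ ?_ ?_ ?_
    · intro x y; simp
    · intro x y; simp
    · intro x y; simp
    · intro x y; simp
    · intro ρ; fin_cases ρ <;> simp [gam] <;> ring
    · simp [slash_eq, avec]; ring
  · refine key 3 0 2 1 (-2 * I) (by simp) (by decide) (by decide) ?_ ?_ ?_ ?_ ?_ ?_
    · intro x y; simp [sub_eq_add_neg]
    · intro x y; simp [sub_eq_add_neg]
    · intro x y; simp [sub_eq_add_neg]
    · intro x y; simp [sub_eq_add_neg]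
    · intro ρ; fin_cases ρ <;> simp [gam] <;> ring
    · simp [slash_eq, avec]; ring

/-- The equations at second order for the couplings of the higgs field. -/
theorem SecondOrder.higgs_chir {P : Params} (hg : P.g ≠ 0) (hM : ∀ a ≠ 3, P.mass a ≠ 0)
    {κ : Couplings} {Q : FermiCurrent} {c : Renorm} (h : SecondOrder P κ Q c)
    (hq : ∀ a f f', Q.q a f f' = κ.bv a f f') (hqt : ∀ a f f', Q.qt a f f' = κ.bvt a f f')
    {s : ℂ} (hs : s = 1 ∨ s = -1) {b : Fin 4} (hb : b ≠ 3) (f f' : Lepton) :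
    I / (2 * P.mW : ℂ) * κ.S s b f f'
      + ∑ h, (κ.H s f h * κ.B s b h f' - κ.B (-s) b f h * κ.H s h f') = 0 := by
  have hn := h.higgs hg hM hb f f'
  simp only [hq, hqt, κ.higgs_eq, κ.scal_eq, chir_eq', chir_eq] at hn
  rcases hs with rfl | rfl
  · have h1 := congrFun (congrFun hn 2) 2
    simp only [Matrix.add_apply, Matrix.smul_apply, Matrix.sub_apply, Matrix.sum_apply,
      mul_diagonal, diagonal_apply_eq, smul_eq_mul, Matrix.zero_apply] at h1
    simpa [Couplings.S, Couplings.H, Couplings.B, sub_eq_add_neg]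
      using h1
  · have h1 := congrFun (congrFun hn 0) 0
    simp only [Matrix.add_apply, Matrix.smul_apply, Matrix.sub_apply, Matrix.sum_apply,
      mul_diagonal, diagonal_apply_eq, smul_eq_mul, Matrix.zero_apply] at h1
    simpa [Couplings.S, Couplings.H, Couplings.B, sub_eq_add_neg]
      using h1

/-- Mass differences and sums recombine so that the left mass multiplies chirality `s` and the right
mass the opposite one. -/
theorem Couplings.S_eq {P : Params} {κ : Couplings}
    (hc : ∀ a f f', κ.cs a f f' = I * ((P.lmass f - P.lmass f') * κ.bv a f f'))
    (hct : ∀ a f f', κ.cst a f f' = I * ((P.lmass f + P.lmass f') * κ.bvt a f f'))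
    (s : ℂ) (a : Fin 4) (f f' : Lepton) :
    κ.S s a f f' = I * (P.lmass f * κ.B s a f f' - P.lmass f' * κ.B (-s) a f f') := by
  rw [Couplings.S, hc, hct, Couplings.B, Couplings.B]
  ring

/-- The solution of the equations for the chirality components: unprimed variables are those of the
chirality that couples to the charged vector bosons, primed ones those of the opposite chirality. -/
theorem chirality_algebra {M N c sn mW x x' y y' ze ze' zn zn' he he' hn hn' b R T : ℂ}
    (hM : M ≠ 0) (hMN : M ^ 2 ≠ N ^ 2) (hc : c ≠ 0) (hcs : c ^ 2 + sn ^ 2 = 1) (hmW : mW ≠ 0)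
    (hx : x ≠ 0) (hy : y ≠ 0) (hy' : x' = 0 → y' = 0)
    (h1 : (b - sn) * (M * x - N * x') = 0)
    (h2 : 2 * c * (M * (ze - ze') * x - N * (zn - zn') * x') = M * x - N * x')
    (h2' : 2 * c * (M * (ze' - ze) * x' - N * (zn' - zn) * x) = M * x' - N * x)
    (h3 : 2 * c * (ze' - zn) * (M * x - N * x') = (2 * c ^ 2 - 1) * (M * x - N * x'))
    (h4 : mW * he = M * (x * y + x' * y') - 2 * N * x' * y)
    (h5 : x * y = R * ze + T) (h5' : x' * y' = R * ze' + T)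
    (h6 : -(x * y) = R * zn) (h6' : -(x' * y') = R * zn')
    (h7 : 2 * mW * (he * x - x' * hn) = M * x - N * x')
    (h7' : 2 * mW * (he' * x' - x * hn') = M * x' - N * x)
    (h8 : 2 * mW * (hn * y - y' * he) = N * y - M * y')
    (h8' : 2 * mW * (hn' * y' - y * he') = N * y' - M * y) :
    x' = 0 ∧ x * y = 1 / 2 ∧ b = sn ∧ ze = (1 - 2 * sn ^ 2) / (2 * c) ∧ ze' = -sn ^ 2 / c ∧
      zn = -1 / (2 * c) ∧ zn' = 0 ∧ he = M / (2 * mW) ∧ he' = M / (2 * mW) ∧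
      hn = N / (2 * mW) ∧ hn' = N / (2 * mW) := by
  have hR : R ≠ 0 := by
    rintro rfl
    rw [zero_mul, neg_eq_zero] at h6
    exact mul_ne_zero hx hy h6
  -- The sum of the `e` and `ν` relations is `R (ze + zn) + T = 0` for either chirality; subtracting
  -- eliminates the unknown `T`.
  have hzn : zn - zn' = -(ze - ze') := by
    apply mul_left_cancel₀ hR
    linear_combination -h6 + h6' - h5 + h5'
  set δ := 2 * c * (ze - ze') with hδ
  have g1 : M * (δ - 1) * x + N * (δ + 1) * x' = 0 := by
    rw [hδ]
    linear_combination h2 + 2 * c * N * x' * hzn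
  have g2 : M * (δ + 1) * x' + N * (δ - 1) * x = 0 := by
    rw [hδ]
    linear_combination -h2' + 2 * c * N * x * hzn
  -- Because `M² ≠ N²`, the linear system `g1`, `g2` decouples into `(δ - 1) x = 0` and `(δ + 1) x'
  -- = 0`.
  have hx' : x' = 0 := by
    by_contra h0
    have g3 : (M ^ 2 - N ^ 2) * ((δ - 1) * x) = 0 := by linear_combination M * g1 - N * g2
    have g4 : (M ^ 2 - N ^ 2) * ((δ + 1) * x') = 0 := by linear_combination M * g2 - N * g1
    have k3 := (mul_eq_zero.1 g3).resolve_left (sub_ne_zero.2 hMN)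
    have k4 := (mul_eq_zero.1 g4).resolve_left (sub_ne_zero.2 hMN)
    have j3 := (mul_eq_zero.1 k3).resolve_right hx
    have j4 := (mul_eq_zero.1 k4).resolve_right h0
    have : (2 : ℂ) = 0 := by linear_combination j4 - j3
    exact two_ne_zero this
  have hy0 := hy' hx'
  subst hx' hy0
  have hMx : M * x ≠ 0 := mul_ne_zero hM hx
  have hb : b = sn := by
    apply mul_right_cancel₀ hMx
    linear_combination h1
  have hδ1 : δ = 1 := by
    apply mul_right_cancel₀ hMx
    linear_combination g1
  rw [hδ] at hδ1
  have hz3 : 2 * c * (ze' - zn) = 2 * c ^ 2 - 1 := by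
    apply mul_right_cancel₀ hMx
    linear_combination h3
  have ke : 2 * mW * he = M := by
    apply mul_right_cancel₀ hx
    linear_combination h7
  have ke' : 2 * mW * he' = M := by
    apply mul_right_cancel₀ hy
    linear_combination -h8'
  have kn : 2 * mW * hn = N := by
    apply mul_right_cancel₀ hy
    linear_combination h8
  have kn' : 2 * mW * hn' = N := by
    apply mul_right_cancel₀ hx
    linear_combination -h7'
  -- The higgs coupling is determined twice, linearly by `h7` and quadratically by `h4`; this fixes
  -- the normalization.
  have hxy : x * y = 1 / 2 := by
    apply mul_left_cancel₀ hM
    linear_combination ke / 2 - h4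
  have hzn' : zn' = 0 := by
    apply mul_left_cancel₀ hR
    linear_combination -h6'
  have hRc : R = c := by
    linear_combination (-R) * hδ1 + 2 * c * (h5' - h5 + hxy)
  rw [hRc] at h6
  have kz : 2 * c * zn = -1 := by linear_combination -2 * h6 - 2 * hxy
  have kze' : c * ze' = -sn ^ 2 := by linear_combination (hz3 + kz) / 2 + hcs
  have kze : 2 * c * ze = 1 - 2 * sn ^ 2 := by linear_combination hδ1 + 2 * kze'
  have h2c : 2 * c ≠ 0 := mul_ne_zero two_ne_zero hc
  have h2m : 2 * mW ≠ 0 := mul_ne_zero two_ne_zero hmW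
  refine ⟨rfl, hxy, hb, ?_, ?_, ?_, hzn', ?_, ?_, ?_, ?_⟩
  · rw [eq_div_iff h2c]; linear_combination kze
  · rw [eq_div_iff hc]; linear_combination kze'
  · rw [eq_div_iff h2c]; linear_combination kz
  · rw [eq_div_iff h2m]; linear_combination ke
  · rw [eq_div_iff h2m]; linear_combination ke'
  · rw [eq_div_iff h2m]; linear_combination kn
  · rw [eq_div_iff h2m]; linear_combination kn'

/-- String independence determines the chirality components of the couplings. -/
theorem StringIndependent.chirality {P : Params} (hg : P.g ≠ 0) (hW : 0 < P.mW)
    (hZ : P.mW < P.mZ) (he : 0 < P.me) (hν : 0 ≤ P.mν) (hne : P.me ≠ P.mν)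
    (hΘ : Real.cos P.Θ = P.mW / P.mZ) {κ : Couplings} {Q : FermiCurrent} {c : Renorm}
    (h : SecondOrder P κ Q c)
    (hq : ∀ a f f', Q.q a f f' = κ.bv a f f') (hqt : ∀ a f f', Q.qt a f f' = κ.bvt a f f')
    (hc : ∀ a f f', κ.cs a f f' = I * ((P.lmass f - P.lmass f') * κ.bv a f f'))
    (hct : ∀ a f f', κ.cst a f f' = I * ((P.lmass f + P.lmass f') * κ.bvt a f f'))
    (h6 : κ.b6 = 0) (h6t : κ.bt6 = 0) (h5t : κ.bt5 = 0)
    (hb2 : κ.b2 = (starRingEnd ℂ) κ.b1) (hbt2 : κ.bt2 = (starRingEnd ℂ) κ.bt1)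
    {s : ℝ} (hs : s = 1 ∨ s = -1) (hx : κ.b1 + s * κ.bt1 ≠ 0) :
    κ.b1 - s * κ.bt1 = 0 ∧ (κ.b1 + s * κ.bt1) * (κ.b2 + s * κ.bt2) = 1 / 2 ∧
      κ.b5 = Real.sin P.Θ ∧
      κ.b3 + s * κ.bt3 = (1 - 2 * (Real.sin P.Θ : ℂ) ^ 2) / (2 * Real.cos P.Θ) ∧
      κ.b3 - s * κ.bt3 = -(Real.sin P.Θ : ℂ) ^ 2 / Real.cos P.Θ ∧
      κ.b4 + s * κ.bt4 = -1 / (2 * Real.cos P.Θ) ∧ κ.b4 - s * κ.bt4 = 0 ∧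
      κ.c0 + s * κ.ct0 = P.me / (2 * P.mW) ∧ κ.c0 - s * κ.ct0 = P.me / (2 * P.mW) ∧
      κ.c5 + s * κ.ct5 = P.mν / (2 * P.mW) ∧ κ.c5 - s * κ.ct5 = P.mν / (2 * P.mW) := by
  have hM : ∀ a ≠ 3, P.mass a ≠ 0 := fun a ha => mass_ne_zero hW hZ ha
  have hs' : (s : ℂ) = 1 ∨ (s : ℂ) = -1 := by
    rcases hs with rfl | rfl
    · left; norm_num
    · right; norm_num
  have hs2 : -(s : ℂ) = 1 ∨ -(s : ℂ) = -1 := by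
    rcases hs' with h0 | h0 <;> rw [h0]
    · right; rfl
    · left; norm_num
  have hZ0 : (P.mZ : ℂ) ≠ 0 := by exact_mod_cast (hW.trans hZ).ne'
  have hW0 : (P.mW : ℂ) ≠ 0 := by exact_mod_cast hW.ne'
  have hcos : (Real.cos P.Θ : ℂ) ≠ 0 := by
    rw [hΘ]; push_cast; exact div_ne_zero hW0 hZ0
  have hmW : (P.mW : ℂ) = Real.cos P.Θ * P.mZ := by
    rw [hΘ]; push_cast; field_simp
  have hcs : (Real.cos P.Θ : ℂ) ^ 2 + (Real.sin P.Θ : ℂ) ^ 2 = 1 := by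
    exact_mod_cast Real.cos_sq_add_sin_sq P.Θ
  have hsqrt : ((Real.sqrt 2 : ℝ) : ℂ) ^ 2 = 2 := by
    exact_mod_cast Real.sq_sqrt (by norm_num : (0 : ℝ) ≤ 2)
  have hsqrt0 : ((Real.sqrt 2 : ℝ) : ℂ) ≠ 0 := by simp
  obtain ⟨r, hr⟩ := h.vector hg hM hq hqt 0 (a := 1) (by decide)
  have eqs : ∀ s : ℂ, s = 1 ∨ s = -1 →
      ((κ.b5 - Real.sin P.Θ) * (P.me * (κ.b1 + s * κ.bt1) - P.mν * (κ.b1 - s * κ.bt1)) = 0 ∧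
      2 * Real.cos P.Θ * (P.me * (κ.b3 + s * κ.bt3 - (κ.b3 - s * κ.bt3)) * (κ.b1 + s * κ.bt1)
        - P.mν * (κ.b4 + s * κ.bt4 - (κ.b4 - s * κ.bt4)) * (κ.b1 - s * κ.bt1))
        = P.me * (κ.b1 + s * κ.bt1) - P.mν * (κ.b1 - s * κ.bt1) ∧
      2 * Real.cos P.Θ * (κ.b3 - s * κ.bt3 - (κ.b4 + s * κ.bt4))
        * (P.me * (κ.b1 + s * κ.bt1) - P.mν * (κ.b1 - s * κ.bt1))
        = (2 * (Real.cos P.Θ : ℂ) ^ 2 - 1)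
          * (P.me * (κ.b1 + s * κ.bt1) - P.mν * (κ.b1 - s * κ.bt1)) ∧
      P.mW * (κ.c0 + s * κ.ct0) = P.me * ((κ.b1 + s * κ.bt1) * (κ.b2 + s * κ.bt2)
        + (κ.b1 - s * κ.bt1) * (κ.b2 - s * κ.bt2))
        - 2 * P.mν * (κ.b1 - s * κ.bt1) * (κ.b2 + s * κ.bt2) ∧
      (κ.b1 + s * κ.bt1) * (κ.b2 + s * κ.bt2) = -I * Real.cos P.Θ * r 2 / 2 * (κ.b3 + s * κ.bt3)
        + -I * κ.b5 * Real.sin P.Θ * r 3 / 2 ∧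
      -((κ.b1 + s * κ.bt1) * (κ.b2 + s * κ.bt2))
        = -I * Real.cos P.Θ * r 2 / 2 * (κ.b4 + s * κ.bt4) ∧
      2 * P.mW * ((κ.c0 + s * κ.ct0) * (κ.b1 + s * κ.bt1)
        - (κ.b1 - s * κ.bt1) * (κ.c5 + s * κ.ct5))
        = P.me * (κ.b1 + s * κ.bt1) - P.mν * (κ.b1 - s * κ.bt1) ∧
      2 * P.mW * ((κ.c5 + s * κ.ct5) * (κ.b2 + s * κ.bt2)
        - (κ.b2 - s * κ.bt2) * (κ.c0 + s * κ.ct0))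
        = P.mν * (κ.b2 + s * κ.bt2) - P.me * (κ.b2 - s * κ.bt2)) := by
    intro s hs
    -- The pairs are photon–W for the electric charge, W–Z in both orders for the Z couplings, W–W
    -- for the higgs coupling; then the commutator of `W_1` and `W_2` between equal leptons, and the
    -- higgs leg with W.
    have e1 := h.scalar hg hM hq hqt hs 3 (a := 0) (by decide) .e .ν
    have e2 := h.scalar hg hM hq hqt hs 0 (a := 2) (by decide) .e .ν
    have e3 := h.scalar hg hM hq hqt hs 2 (a := 0) (by decide) .e .ν
    have e4 := h.scalar hg hM hq hqt hs 0 (a := 0) (by decide) .e .e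
    have e5 := hr s hs .e .e
    have e6 := hr s hs .ν .ν
    have e7 := h.higgs_chir hg hM hq hqt hs (b := 0) (by decide) .e .ν
    have e8 := h.higgs_chir hg hM hq hqt hs (b := 0) (by decide) .ν .e
    clear hq hqt h hr
    simp [Couplings.S_eq hc hct, sum_lepton, Fin.sum_univ_four, escortCoeff, higgsCoeff,
      Params.f, kron3, Matrix.det_fin_three, Params.mass, Couplings.B, Couplings.bv, Couplings.bvt,
      realBasis, h6, h6t, h5t, Params.lmass, Couplings.H, Couplings.hs, Couplings.hst,
      ← sub_eq_add_neg] at e1 e2 e3 e4 e5 e6 e7 e8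
    clear hc hct
    simp only [← ofReal_cos, ← ofReal_sin] at *
    generalize ((Real.cos P.Θ : ℝ) : ℂ) = C at *
    rw [hmW] at e2 e3
    generalize ((Real.sqrt 2 : ℝ) : ℂ) = q at *
    field_simp at e1 e2 e3 e4 e5 e6 e7 e8
    simp only [I_sq, hsqrt] at e1 e2 e3 e4 e5 e6 e7 e8
    refine ⟨?_, ?_, ?_, ?_, ?_, ?_, ?_, ?_⟩
    · linear_combination -e1 / 2
    · linear_combination e2
    · linear_combination -e3
    · linear_combination -e4 / 2
    · linear_combination -I / 4 * e5 + (κ.b1 + s * κ.bt1) * (κ.b2 + s * κ.bt2) * I_mul_I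
    · linear_combination -I / 4 * e6 - (κ.b1 + s * κ.bt1) * (κ.b2 + s * κ.bt2) * I_mul_I
    · linear_combination e7
    · linear_combination e8
  obtain ⟨p1, p2, p3, p4, p5, p6, p7, p8⟩ := eqs s hs'
  obtain ⟨-, n2, -, -, n5, n6, n7, n8⟩ := eqs (-s) hs2
  simp only [neg_mul, sub_neg_eq_add, ← sub_eq_add_neg] at n2 n5 n6 n7 n8
  have hconj : ∀ z : ℂ, (z = 1 ∨ z = -1) → κ.b2 + z * κ.bt2 = (starRingEnd ℂ) (κ.b1 + z * κ.bt1) := by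
    rintro z (rfl | rfl) <;> simp [hb2, hbt2]
  refine chirality_algebra (y' := κ.b2 - s * κ.bt2) (by exact_mod_cast he.ne') ?_ hcos hcs hW0 hx ?_
    ?_ p1 p2 n2 p3 p4 p5 ?_ p6 ?_ p7 n7 p8 n8
  · intro h0
    have h1 : P.me ^ 2 = P.mν ^ 2 := by exact_mod_cast h0
    exact hne ((sq_eq_sq₀ he.le hν).1 h1)
  · rw [hconj s hs']
    exact (map_ne_zero _).2 hx
  · intro h0
    have h1 := hconj (-s) hs2
    rw [neg_mul, ← sub_eq_add_neg, neg_mul, ← sub_eq_add_neg, h0, map_zero] at h1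
    exact h1
  · linear_combination n5
  · linear_combination n6

/-- For the time component, `gam 0` cancels from the adjoint relation, leaving diagonal matrices
whose entries are the two chirality components. -/
theorem Couplings.IsHermitian.charged {κ : Couplings} (h : κ.IsHermitian) :
    κ.b2 = (starRingEnd ℂ) κ.b1 ∧ κ.bt2 = (starRingEnd ℂ) κ.bt1 := by
  have h0 := h.1 0 .e .ν 0
  simp only [Couplings.vec_eq, chir_eq] at h0
  have hγ : (gam 0)ᴴ * gam 0 = 1 := by
    ext i j
    fin_cases i <;> fin_cases j <;> simp [gam, Matrix.mul_apply, Fin.sum_univ_four]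
  rw [conjTranspose_mul, mul_assoc, mul_assoc, hγ, mul_one] at h0
  have h1 := congrArg (fun X => (gam 0)ᴴ * X) h0
  simp only [← mul_assoc, hγ, one_mul, diagonal_conjTranspose] at h1
  have h2 := congrFun (diagonal_injective h1) 0
  have h3 := congrFun (diagonal_injective h1) 2
  have hsqrt0 : ((Real.sqrt 2 : ℝ) : ℂ) ≠ 0 := by simp
  simp [Couplings.bv, Couplings.bvt, realBasis] at h2 h3
  field_simp at h2 h3
  constructor
  · linear_combination (h2 + h3) / 2
  · linear_combination (h3 - h2) / 2

end StringLocal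

end

/-! ### Assembly of the couplings from their chirality components -/

theorem mainTheorem1 (P : StringLocal.Params) (hg : P.g ≠ 0)
    (hW : 0 < P.mW) (hZ : P.mW < P.mZ) (hH : 0 < P.mH) (he : 0 < P.me) (hν : 0 ≤ P.mν)
    (hne : P.me ≠ P.mν) (hΘ : Real.cos P.Θ = P.mW / P.mZ)
    (κ : StringLocal.Couplings) (hherm : κ.IsHermitian)
    (hphoton : κ.b6 = 0 ∧ κ.bt6 = 0) (hcharged : κ.b1 ≠ 0 ∨ κ.bt1 ≠ 0)
    (hSI : StringLocal.StringIndependent P κ) :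
    ∃ (ε : ℝ) (ζ : ℂ), (ε = 1 ∨ ε = -1) ∧ ‖ζ‖ = 1 ∧
      κ =
        { b1 := -ζ / (2 * Real.sqrt 2 : ℝ)
          bt1 := -ε * ζ / (2 * Real.sqrt 2 : ℝ)
          b2 := -(starRingEnd ℂ) ζ / (2 * Real.sqrt 2 : ℝ)
          bt2 := -ε * (starRingEnd ℂ) ζ / (2 * Real.sqrt 2 : ℝ)
          b3 := ((1 - 4 * Real.sin P.Θ ^ 2) / (4 * Real.cos P.Θ) : ℝ)
          bt3 := (ε / (4 * Real.cos P.Θ) : ℝ)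
          b4 := (-1 / (4 * Real.cos P.Θ) : ℝ)
          bt4 := (-ε / (4 * Real.cos P.Θ) : ℝ)
          b5 := (Real.sin P.Θ : ℝ)
          bt5 := 0
          b6 := 0
          bt6 := 0
          c1 := -Complex.I * ((P.me - P.mν) / (2 * Real.sqrt 2) : ℝ) * ζ
          ct1 := -Complex.I * (ε * (P.me + P.mν) / (2 * Real.sqrt 2) : ℝ) * ζ
          c2 := Complex.I * ((P.me - P.mν) / (2 * Real.sqrt 2) : ℝ) * (starRingEnd ℂ) ζ
          ct2 := -Complex.I * (ε * (P.me + P.mν) / (2 * Real.sqrt 2) : ℝ) * (starRingEnd ℂ) ζ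
          c3 := 0
          ct3 := Complex.I * (ε * P.me / (2 * Real.cos P.Θ) : ℝ)
          c4 := 0
          ct4 := -Complex.I * (ε * P.mν / (2 * Real.cos P.Θ) : ℝ)
          c0 := (P.me / (2 * P.mW) : ℝ)
          ct0 := 0
          c5 := (P.mν / (2 * P.mW) : ℝ)
          ct5 := 0 } := by
  open StringLocal in
  obtain ⟨Q, hF, c, hS⟩ := hSI
  have hco := hF.coeffs hg
  have hc : ∀ a f f', κ.cs a f f' = Complex.I * ((P.lmass f - P.lmass f') * κ.bv a f f') :=
    fun a f f' => (hco a f f').2.2.1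
  have hct : ∀ a f f', κ.cst a f f' = Complex.I * ((P.lmass f + P.lmass f') * κ.bvt a f f') :=
    fun a f f' => (hco a f f').2.2.2
  have heC : (P.me : ℂ) ≠ 0 := by exact_mod_cast he.ne'
  have hsqrt0 : ((Real.sqrt 2 : ℝ) : ℂ) ≠ 0 := by simp
  have hsqrt : ((Real.sqrt 2 : ℝ) : ℂ) ^ 2 = 2 := by
    exact_mod_cast Real.sq_sqrt (by norm_num : (0 : ℝ) ≤ 2)
  -- The photon has no escort coupling, so the first-order relation reads `0 = 2 I m_e bt5`.
  have h5t : κ.bt5 = 0 := by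
    have h := hct 3 .e .e
    simp only [Couplings.cst, Couplings.bvt, realBasis, Params.lmass] at h
    have h' : Complex.I * (2 * P.me) * κ.bt5 = 0 := by linear_combination -h
    exact (mul_eq_zero.1 h').resolve_left
      (mul_ne_zero Complex.I_ne_zero (mul_ne_zero two_ne_zero heC))
  -- The sign `ε` chosen next is a chirality that couples to `W`; by the algebra it is then the only
  -- one.
  obtain ⟨hb2, hbt2⟩ := hherm.charged
  obtain ⟨ε, hε, hx⟩ : ∃ ε : ℝ, (ε = 1 ∨ ε = -1) ∧ κ.b1 + ε * κ.bt1 ≠ 0 := by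
    by_contra hcon
    push Not at hcon
    have h1 := hcon 1 (Or.inl rfl)
    have h2 := hcon (-1) (Or.inr rfl)
    push_cast at h1 h2
    rcases hcharged with h | h
    · apply h
      linear_combination (h1 + h2) / 2
    · apply h
      linear_combination (h1 - h2) / 2
  obtain ⟨r1, r2, r3, r4, r5, r6, r7, r8, r9, r10, r11⟩ :=
    StringIndependent.chirality hg hW hZ he hν hne hΘ hS (fun a f f' => (hco a f f').1)
      (fun a f f' => (hco a f f').2.1) hc hct hphoton.1 hphoton.2 h5t hb2 hbt2 hε hx
  have hε2 : (ε : ℂ) * ε = 1 := by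
    rcases hε with rfl | rfl <;> norm_num
  have hcos : (Real.cos P.Θ : ℂ) ≠ 0 := by
    rw [hΘ]
    exact_mod_cast (div_pos hW (hW.trans hZ)).ne'
  have hW0 : (P.mW : ℂ) ≠ 0 := by exact_mod_cast hW.ne'
  have hb1 : κ.bt1 = ε * κ.b1 := by linear_combination -ε * r1 - κ.bt1 * hε2
  have hbt2' : κ.bt2 = ε * κ.b2 := by rw [hbt2, hb1, hb2]; simp
  have hbb : κ.b1 * κ.b2 = 1 / 8 := by
    rw [hb1, hbt2'] at r2
    linear_combination r2 / 4 - κ.b1 * κ.b2 * ((3 + ε * ε) / 4) * hε2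
  have hbs : ∀ x y z : ℂ, x + ε * y = z → x - ε * y = z → y = 0 := fun x y z h1 h2 => by
    linear_combination -(y * hε2) + ε / 2 * (h1 - h2)
  have e3 : κ.b3 = (1 - 4 * (Real.sin P.Θ : ℂ) ^ 2) / (4 * Real.cos P.Θ) := by
    field_simp at r4 r5 ⊢
    linear_combination r4 + 2 * r5
  have e3t : κ.bt3 = ε / (4 * Real.cos P.Θ) := by
    field_simp at r4 r5 ⊢
    linear_combination ε * r4 - 2 * ε * r5 - 4 * κ.bt3 * Real.cos P.Θ * hε2
  have e4 : κ.b4 = -1 / (4 * Real.cos P.Θ) := by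
    field_simp at r6 ⊢
    linear_combination r6 + 2 * Real.cos P.Θ * r7
  have e4t : κ.bt4 = -ε / (4 * Real.cos P.Θ) := by
    field_simp at r6 ⊢
    linear_combination ε * r6 - 2 * ε * Real.cos P.Θ * r7 - 4 * κ.bt4 * Real.cos P.Θ * hε2
  have f1 := hc 0 .e .ν
  have f1t := hct 0 .e .ν
  have f2 := hc 0 .ν .e
  have f2t := hct 0 .ν .e
  have f3 := hc 2 .e .e
  have f3t := hct 2 .e .e
  have f4 := hc 2 .ν .ν
  have f4t := hct 2 .ν .ν
  simp only [Couplings.cs, Couplings.cst, Couplings.bv, Couplings.bvt, realBasis, Params.lmass]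
    at f1 f1t f2 f2t f3 f3t f4 f4t
  have hconj : (starRingEnd ℂ) (-(2 * (Real.sqrt 2 : ℂ)) * κ.b1) = -(2 * (Real.sqrt 2 : ℂ)) * κ.b2 := by
    rw [hb2, map_mul, map_neg, map_mul, Complex.conj_ofReal, Complex.conj_ofNat]
  -- The phase is read off from `b1`; its modulus is 1 because `b1 b2 = 1/8` and `b2` is the
  -- conjugate of `b1`.
  refine ⟨ε, -(2 * (Real.sqrt 2 : ℂ)) * κ.b1, hε, ?_, ?_⟩
  · have h1 : ((‖-(2 * (Real.sqrt 2 : ℂ)) * κ.b1‖ : ℝ) : ℂ) ^ 2 = 1 := by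
      rw [← Complex.mul_conj', hconj]
      linear_combination 4 * κ.b1 * κ.b2 * hsqrt + 8 * hbb
    have h2 : ‖-(2 * (Real.sqrt 2 : ℂ)) * κ.b1‖ ^ 2 = 1 := by exact_mod_cast h1
    exact (sq_eq_sq₀ (norm_nonneg _) zero_le_one).1 (by rw [h2, one_pow])
  rw [hconj]
  refine Couplings.ext ?_ ?_ ?_ ?_ ?_ ?_ ?_ ?_ ?_ ?_ ?_ ?_ ?_ ?_ ?_ ?_ ?_ ?_ ?_ ?_ ?_ ?_ ?_ ?_
  · push_cast; field_simp
  · push_cast; field_simp; exact hb1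
  · push_cast; field_simp
  · push_cast; field_simp; exact hbt2'
  · rw [e3]; push_cast; rfl
  · rw [e3t]; push_cast; rfl
  · rw [e4]; push_cast; rfl
  · rw [e4t]; push_cast; rfl
  · exact r3
  · exact h5t
  · exact hphoton.1
  · exact hphoton.2
  · push_cast; field_simp at f1 ⊢; linear_combination f1
  · push_cast; rw [hb1] at f1t; field_simp at f1t ⊢; linear_combination f1t
  · push_cast; field_simp at f2 ⊢; linear_combination f2
  · push_cast; rw [hbt2'] at f2t; field_simp at f2t ⊢; linear_combination f2t
  · rw [f3]; ring
  · rw [f3t, e3t]; push_cast; field_simp; ring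
  · rw [f4]; ring
  · rw [f4t, e4t]; push_cast; field_simp; ring
  · push_cast; linear_combination (r8 + r9) / 2
  · exact hbs _ _ _ r8 r9
  · push_cast; linear_combination (r10 + r11) / 2
  · exact hbs _ _ _ r10 r11
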